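/- There are universal constants $C,K>0$ such that the following holds. Let $m\ge 2$, $n\ge 1$, and let $\mathcal A=(A_1,\dots,A_k)$ be a tuple of real $m\times n$ matrices. Put $s(\mathcal A)=\sum_i\|A_i\|_F^2$. Let $\varepsilon\ge 0$ and $\lambda>0$, and suppose that: (i) $\mathcal A$ is $\varepsilon$-nearly doubly balanced, i.e. $$(1-\varepsilon)\tfrac{s(\mathcal A)}{m}I_m\preceq\sum_i A_iA_i^{*}\preceq(1+\varepsilon)\tfrac{s(\mathcal A)}{m}I_m,\qquad (1-\varepsilon)\tfrac{s(\mathcal A)}{n}I_n\preceq\sum_i A_i^{*}A_i\preceq(1+\varepsilon)\tfrac{s(\mathcal A)}{n}I_n;$$ (ii) $\mathcal A$ has a $\lambda$-spectral gap: the second largest singular value satisfies $\sigma_2\big(\sum_i A_i\otimes A_i\big)\le(1-\lambda)\,s(\mathcal A)/\sqrt{mn}$; (iii) $\lambda^2\ge C\,\varepsilon\log m$. For an operator $\mathcal B=(B_1,\dots,B_k)$ let $E(\mathcal B)=s(\mathcal B)I_m-m\sum_jB_jB_j^{*}$ and $F(\mathcal B)=s(\mathcal B)I_n-n\sum_jB_j^{*}B_j$.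 Then the gradient flow $$\tfrac{d}{dt}A_i^{(t)}=E(\mathcal A^{(t)})\,A_i^{(t)}+A_i^{(t)}\,F(\mathcal A^{(t)})\quad(1\le i\le k),\qquad \mathcal A^{(0)}=\mathcal A,$$ has a solution for all $t\ge 0$, and for every such solution the following holds. For every $t\ge 0$ the product integrals $$L^{(t)}=\prod_{0}^{t}\big(I_m+E(\mathcal A^{(\tau)})\,d\tau\big),\qquad R^{(t)}=\big(I_n+F(\mathcal A^{(\tau)})\,d\tau\big)\prod_{0}^{t}$$ (the limits, as the mesh of the partition $0=t_0<\dots<t_N=t$ tends to $0$, of the products of the factors $I+E(\mathcal A^{(t_{j})})(t_{j+1}-t_j)$, with later times on the left, respectively of the factors $I+F(\mathcal A^{(t_{j})})(t_{j+1}-t_j)$, with later times on the right) exist and satisfy $A_i^{(t)}=L^{(t)}A_iR^{(t)}$ for all $i$. The matrices $L^{(t)},R^{(t)}$ are invertible and their condition numbers $\kappa=\sigma_{\max}/\sigma_{\min}$ satisfy $$\kappa(L^{(t)})\le 1+K\,\frac{\varepsilon\log m}{\lambda},\qquad \kappa(R^{(t)})\le 1+K\,\frac{\varepsilon\log m}{\lambda};$$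 moreover $\|L^{(t)}-I_m\|_{\rm op}\le K\varepsilon\log m/\lambda$ and $\|R^{(t)}-I_n\|_{\rm op}\le K\varepsilon\log m/\lambda$. Finally, the limits $L^{(\infty)}=\lim_{t\to\infty}L^{(t)}$ and $R^{(\infty)}=\lim_{t\to\infty}R^{(t)}$ exist, the operator $(L^{(\infty)}A_iR^{(\infty)})_{i}$ is doubly balanced (that is, (i) holds for it with $\varepsilon=0$) and has positive size if $\mathcal A\ne 0$, and $L^{(\infty)},R^{(\infty)}$ are invertible and satisfy the same bounds. -/

import Mathlib

open scoped Kronecker Matrix Matrix.Norms.L2Operator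

namespace OperatorScaling

noncomputable section

/-- The size `s(A) = ∑ i, ‖A i‖_F ^ 2` of an operator `A = (A_1, …, A_k)`. -/
def size {m n k : ℕ} (A : Fin k → Matrix (Fin m) (Fin n) ℝ) : ℝ :=
  ∑ i, ∑ a, ∑ b, (A i a b) ^ 2

/-- `∑ i, A i * (A i)ᵀ`, the value at `I_n` of the completely positive map of `A`. -/
def leftGram {m n k : ℕ} (A : Fin k → Matrix (Fin m) (Fin n) ℝ) : Matrix (Fin m) (Fin m) ℝ :=
  ∑ i, A i * (A i)ᵀ

/-- `∑ i, (A i)ᵀ * A i`, the value at `I_m` of the adjoint map. -/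
def rightGram {m n k : ℕ} (A : Fin k → Matrix (Fin m) (Fin n) ℝ) : Matrix (Fin n) (Fin n) ℝ :=
  ∑ i, (A i)ᵀ * A i

/-- `A` is `ε`-nearly doubly balanced; the four inequalities are in the Loewner order. -/
def IsNearlyDoublyBalanced {m n k : ℕ} (ε : ℝ) (A : Fin k → Matrix (Fin m) (Fin n) ℝ) : Prop :=
  (leftGram A - ((1 - ε) * (size A / m)) • (1 : Matrix (Fin m) (Fin m) ℝ)).PosSemidef ∧
  (((1 + ε) * (size A / m)) • (1 : Matrix (Fin m) (Fin m) ℝ) - leftGram A).PosSemidef ∧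
  (rightGram A - ((1 - ε) * (size A / n)) • (1 : Matrix (Fin n) (Fin n) ℝ)).PosSemidef ∧
  (((1 + ε) * (size A / n)) • (1 : Matrix (Fin n) (Fin n) ℝ) - rightGram A).PosSemidef

/-- `A` is doubly balanced. -/
def IsDoublyBalanced {m n k : ℕ} (A : Fin k → Matrix (Fin m) (Fin n) ℝ) : Prop :=
  IsNearlyDoublyBalanced 0 A

/-- The `(j + 1)`-st largest singular value of a matrix (with multiplicity; zero beyond the number
of columns), for the Euclidean inner products. -/
def singularValue {ι κ : Type*} [Fintype ι] [Fintype κ] [DecidableEq κ]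
    (M : Matrix ι κ ℝ) (j : ℕ) : ℝ :=
  (Matrix.toEuclideanLin M).singularValues j

/-- The `m² × n²` matrix `∑ i, A i ⊗ A i`. -/
def naturalMatrix {m n k : ℕ} (A : Fin k → Matrix (Fin m) (Fin n) ℝ) :
    Matrix (Fin m × Fin m) (Fin n × Fin n) ℝ :=
  ∑ i, A i ⊗ₖ A i

/-- The `lam`-spectral gap condition `σ₂(∑ i, A i ⊗ A i) ≤ (1 - lam) s(A) / √(m n)`. -/
def HasSpectralGap {m n k : ℕ} (lam : ℝ) (A : Fin k → Matrix (Fin m) (Fin n) ℝ) : Prop :=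
  singularValue (naturalMatrix A) 1 ≤ (1 - lam) * (size A / √((m : ℝ) * n))

/-- The left error matrix `E = s I_m - m ∑ i, A i * (A i)ᵀ`. -/
def errorE {m n k : ℕ} (A : Fin k → Matrix (Fin m) (Fin n) ℝ) : Matrix (Fin m) (Fin m) ℝ :=
  size A • (1 : Matrix (Fin m) (Fin m) ℝ) - (m : ℝ) • leftGram A

/-- The right error matrix `F = s I_n - n ∑ i, (A i)ᵀ * A i`. -/
def errorF {m n k : ℕ} (A : Fin k → Matrix (Fin m) (Fin n) ℝ) : Matrix (Fin n) (Fin n) ℝ :=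
  size A • (1 : Matrix (Fin n) (Fin n) ℝ) - (n : ℝ) • rightGram A

/-- `𝒜` is a trajectory, for all times `t ≥ 0`, of the gradient flow
`d/dt A_i = E A_i + A_i F` started at `A`. -/
def IsGradientFlow {m n k : ℕ} (A : Fin k → Matrix (Fin m) (Fin n) ℝ)
    (𝒜 : ℝ → Fin k → Matrix (Fin m) (Fin n) ℝ) : Prop :=
  𝒜 0 = A ∧ ∀ t : ℝ, 0 ≤ t → ∀ i : Fin k,
    HasDerivWithinAt (fun τ => 𝒜 τ i) (errorE (𝒜 t) * 𝒜 t i + 𝒜 t i * errorF (𝒜 t))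
      (Set.Ici 0) t

/-- The ordered product `(I + (x_N - x_{N-1}) P(x_{N-1})) ⋯ (I + (x_1 - x_0) P(x_0))`. -/
def leftProduct {d : ℕ} (P : ℝ → Matrix (Fin d) (Fin d) ℝ) (x : ℕ → ℝ) :
    ℕ → Matrix (Fin d) (Fin d) ℝ
  | 0 => 1
  | N + 1 => (1 + (x (N + 1) - x N) • P (x N)) * leftProduct P x N

/-- The ordered product `(I + (x_1 - x_0) P(x_0)) ⋯ (I + (x_N - x_{N-1}) P(x_{N-1}))`. -/
def rightProduct {d : ℕ} (P : ℝ → Matrix (Fin d) (Fin d) ℝ) (x : ℕ → ℝ) :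
    ℕ → Matrix (Fin d) (Fin d) ℝ
  | 0 => 1
  | N + 1 => rightProduct P x N * (1 + (x (N + 1) - x N) • P (x N))

/-- `a = x_0 < x_1 < ⋯ < x_N = b` is a partition of `[a, b]` with all steps smaller than `δ`. -/
def IsFinePartition (a b δ : ℝ) (N : ℕ) (x : ℕ → ℝ) : Prop :=
  x 0 = a ∧ x N = b ∧ ∀ i < N, x i < x (i + 1) ∧ x (i + 1) - x i < δ

/-- `Y` is the left product integral `∏_a^b (I + P(t) dt)`: the limit of the left products over
the partitions of `[a, b]`, as the mesh tends to zero. -/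
def IsLeftProductIntegral {d : ℕ} (P : ℝ → Matrix (Fin d) (Fin d) ℝ) (a b : ℝ)
    (Y : Matrix (Fin d) (Fin d) ℝ) : Prop :=
  ∀ η > 0, ∃ δ > 0, ∀ (N : ℕ) (x : ℕ → ℝ), IsFinePartition a b δ N x →
    ‖leftProduct P x N - Y‖ < η

/-- `Y` is the right product integral `(I + P(t) dt) ∏_a^b`: the limit of the right products over
the partitions of `[a, b]`, as the mesh tends to zero. -/
def IsRightProductIntegral {d : ℕ} (P : ℝ → Matrix (Fin d) (Fin d) ℝ) (a b : ℝ)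
    (Y : Matrix (Fin d) (Fin d) ℝ) : Prop :=
  ∀ η > 0, ∃ δ > 0, ∀ (N : ℕ) (x : ℕ → ℝ), IsFinePartition a b δ N x →
    ‖rightProduct P x N - Y‖ < η

/-- The condition number `σ_max / σ_min` of a square matrix
(meaningful for invertible matrices). -/
def conditionNumber {d : ℕ} (M : Matrix (Fin d) (Fin d) ℝ) : ℝ :=
  singularValue M 0 / singularValue M (d - 1)

/-- `M` is invertible, its condition number is at most `1 + x`, and it is within `x` of the
identity in the (Euclidean) operator norm. -/
def IsWellConditioned {d : ℕ} (x : ℝ) (M : Matrix (Fin d) (Fin d) ℝ) : Prop :=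
  IsUnit M ∧ conditionNumber M ≤ 1 + x ∧ ‖M - 1‖ ≤ x

end

end OperatorScaling

open OperatorScaling

/-! Write Φ for the map `cpMap`, s for the size, Δ for `potential`. Along the flow s' = -2Δ and E' =
-2sE - 2mΦ(F) - 2Δ·I + 2E²; transposing every `A i` gives the equation for F. Since L' = E L and R'
= R F, everything reduces to showing that ‖E‖ and ‖F‖ have time integrals of order ε log m / λ.

Two bounds on ‖E‖ are combined. For short times, the damping -2sE absorbs the cross term, because a
positive map has norm ‖Φ(I)‖; what is left is quadratic, so the errors at most double up to a time
of order log m / (λs). For long times, the spectral gap enters. E and F are traceless, hence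
orthogonal to the identities, which are nearly singular vectors of Φ for the value s/√(mn). On their
orthogonal complements Φ is therefore smaller by about a factor 1 - λ, and Δ' ≤ -λsΔ
(`potential_deriv_le`). As ‖E‖² ≤ mΔ, this yields ‖E‖ ≤ 2εs·√m·exp(-λst/2). The minimum of the two
bounds has integral of order ε log m / λ.

The same argument for F would cost log n. Instead F is slaved to E: the damping of F is driven
mainly by Φ*(E), so ‖F‖ stays below twice the bound for ‖E‖ (`FlowData.norm_errorF_le`). This is why
only log m appears.

The gap is assumed at time 0 only. It survives at time t as long as L and R are within a small
multiple of λ of the identity (`inner_cpMap_scaled_le`), and the hypothesis λ² ≥ Cε log m makes the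
resulting bounds better than those assumed, so a continuity argument closes the loop
(`FlowData.isControlled`). Integrable derivatives give the limits of L and R, and E, F → 0 makes the
limit operator doubly balanced. -/

namespace OperatorScaling

open Set Filter Topology
open scoped NNReal

/-! ### Initial value problems on [0, T] and on [0, ∞). -/

section ODE

variable {V : Type*} [NormedAddCommGroup V] [NormedSpace ℝ V]

/-- A derivative within `[0, T]` is a right derivative at every point of `[0, T)`. -/
lemma hasDerivWithinAt_Ici_of_Icc_zero {f : ℝ → V} {f' : V} {T t : ℝ} (ht : t ∈ Ico 0 T)
    (h : HasDerivWithinAt f f' (Icc 0 T) t) : HasDerivWithinAt f f' (Ici t) t :=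
  ((h.mono (Icc_subset_Icc_left ht.1)).mono_of_mem_nhdsWithin (Icc_mem_nhdsGE ht.2))

/-- Uniqueness of the solution on `[0, T]` of an initial value problem with a field that is
Lipschitz at every time. -/
lemma eqOn_Icc_of_lipschitzWith {v : ℝ → V → V} {K : ℝ≥0} {T : ℝ}
    (hv : ∀ t ∈ Icc 0 T, LipschitzWith K (v t)) {f g : ℝ → V}
    (hf : ∀ t ∈ Icc 0 T, HasDerivWithinAt f (v t (f t)) (Icc 0 T) t)
    (hg : ∀ t ∈ Icc 0 T, HasDerivWithinAt g (v t (g t)) (Icc 0 T) t) (h0 : f 0 = g 0) :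
    EqOn f g (Icc 0 T) :=
  ODE_solution_unique_of_mem_Icc_right (s := fun _ => univ)
    (fun t ht => (hv t (Ico_subset_Icc_self ht)).lipschitzOnWith)
    (fun t ht => (hf t ht).continuousWithinAt)
    (fun t ht => hasDerivWithinAt_Ici_of_Icc_zero ht (hf t (Ico_subset_Icc_self ht)))
    (fun _ _ => trivial)
    (fun t ht => (hg t ht).continuousWithinAt)
    (fun t ht => hasDerivWithinAt_Ici_of_Icc_zero ht (hg t (Ico_subset_Icc_self ht)))
    (fun _ _ => trivial) h0

/-- A bounded field that is Lipschitz at every time has a solution on `[0, T]`. -/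
lemma exists_solution_Icc [CompleteSpace V] {v : ℝ → V → V} {K M : ℝ≥0} {T : ℝ} (hT : 0 ≤ T)
    (hv : ∀ t ∈ Icc 0 T, LipschitzWith K (v t))
    (hc : ∀ x, ContinuousOn (fun t => v t x) (Icc 0 T))
    (hM : ∀ t ∈ Icc 0 T, ∀ x, ‖v t x‖ ≤ M) (x₀ : V) :
    ∃ f : ℝ → V, f 0 = x₀ ∧ ∀ t ∈ Icc 0 T, HasDerivWithinAt f (v t (f t)) (Icc 0 T) t := by
  -- Speed at most `M` for a time `T` covers a distance at most `M * T`, so with this radius the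
  -- solution cannot leave the ball before time `T`.
  have h : IsPicardLindelof v (⟨0, le_rfl, hT⟩ : Icc (0 : ℝ) T) x₀ (M * T.toNNReal) 0 M K :=
    { lipschitzOnWith := fun t ht => (hv t ht).lipschitzOnWith
      continuousOn := fun x _ => hc x
      norm_le := fun t ht x _ => hM t ht x
      mul_max_le := by simp [hT] }
  exact h.exists_eq_forall_mem_Icc_hasDerivWithinAt₀

/-- Solutions on all the intervals `[0, T]` glue to a solution on `[0, ∞)`. -/
lemma exists_solution_Ici {v : ℝ → V → V} {x₀ : V}
    (hv : ∀ T : ℝ, ∃ K : ℝ≥0, ∀ t ∈ Icc 0 T, LipschitzWith K (v t))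
    (hs : ∀ T : ℝ, 0 ≤ T → ∃ f : ℝ → V, f 0 = x₀ ∧
      ∀ t ∈ Icc 0 T, HasDerivWithinAt f (v t (f t)) (Icc 0 T) t) :
    ∃ f : ℝ → V, f 0 = x₀ ∧ ∀ t, 0 ≤ t → HasDerivWithinAt f (v t (f t)) (Ici 0) t := by
  choose f hf0 hf using fun N : ℕ => hs N N.cast_nonneg
  have agree : ∀ {M N : ℕ}, M ≤ N → EqOn (f M) (f N) (Icc 0 M) := by
    intro M N hMN
    obtain ⟨K, hK⟩ := hv M
    have hMN' : (M : ℝ) ≤ N := by exact_mod_cast hMN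
    exact eqOn_Icc_of_lipschitzWith hK (hf M)
      (fun t ht => (hf N t ⟨ht.1, ht.2.trans hMN'⟩).mono (Icc_subset_Icc_right hMN'))
      (by rw [hf0, hf0])
  let g : ℝ → V := fun t => f ⌈t⌉₊ t
  have hg : ∀ N : ℕ, EqOn g (f N) (Icc 0 N) := by
    intro N t ht
    exact agree (Nat.ceil_le.mpr ht.2) ⟨ht.1, Nat.le_ceil t⟩
  refine ⟨g, by simp [g, hf0], fun t ht => ?_⟩
  obtain ⟨N, hN⟩ := exists_nat_gt t
  have h1 : HasDerivWithinAt g (v t (g t)) (Icc 0 N) t := by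
    rw [hg N ⟨ht, hN.le⟩]
    exact (hf N t ⟨ht, hN.le⟩).congr (hg N) (hg N ⟨ht, hN.le⟩)
  refine h1.mono_of_mem_nhdsWithin ?_
  rw [← Ici_inter_Iic]
  exact inter_mem self_mem_nhdsWithin (mem_nhdsWithin_of_mem_nhds (Iic_mem_nhds hN))

end ODE

/-! ### Linear equations and product integrals. -/

/-- The linear initial value problem `Y' = P Y`, `Y(0) = 1` has a solution on `[0, ∞)`. -/
lemma exists_linear_solution {R : Type*} [NormedRing R] [NormedAlgebra ℝ R]
    [FiniteDimensional ℝ R] {P : ℝ → R} (hP : ContinuousOn P (Ici 0)) :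
    ∃ Y : ℝ → R, Y 0 = 1 ∧ ∀ t, 0 ≤ t → HasDerivWithinAt Y (P t * Y t) (Ici 0) t := by
  have : CompleteSpace R := FiniteDimensional.complete ℝ R
  have hbd : ∀ T : ℝ, ∃ M : ℝ≥0, ∀ t ∈ Icc 0 T, ‖P t‖ ≤ M := by
    intro T
    obtain ⟨M, hM⟩ := isCompact_Icc.exists_bound_of_continuousOn
      (hP.mono (Icc_subset_Ici_self : Icc 0 T ⊆ Ici 0))
    exact ⟨M.toNNReal, fun t ht => (hM t ht).trans (Real.le_coe_toNNReal M)⟩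
  refine exists_solution_Ici (v := fun t x => P t * x) (fun T => ?_) (fun T hT => ?_)
  · obtain ⟨M, hM⟩ := hbd T
    refine ⟨M, fun t ht => LipschitzWith.of_dist_le_mul fun x y => ?_⟩
    rw [dist_eq_norm, dist_eq_norm, ← mul_sub]
    exact (norm_mul_le _ _).trans (by gcongr; exact hM t ht)
  · obtain ⟨M, hM⟩ := hbd T
    -- A radius above the Grönwall bound ‖1‖·exp(MT). The cutoff only shrinks vectors, so the
    -- truncated equation obeys the same bound, its solution stays where the cutoff equals 1, and it
    -- solves the original equation.
    let ρ : ℝ := (‖(1 : R)‖ + 1) * Real.exp (M * T)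
    have hρ : 0 < ρ := by positivity
    let χ : ContDiffBump (0 : R) := ⟨ρ, ρ + 1, hρ, by linarith⟩
    let h : R → R := fun x => χ x • x
    have hcont : ContDiff ℝ 1 h := χ.contDiff.smul contDiff_id
    have hcomp : HasCompactSupport h := χ.hasCompactSupport.smul_right
    obtain ⟨K, hK⟩ := hcont.lipschitzWith_of_hasCompactSupport hcomp one_ne_zero
    obtain ⟨B, hB⟩ := hcomp.exists_bound_of_continuous hcont.continuous
    have hle : ∀ x, ‖h x‖ ≤ ‖x‖ := fun x => by
      rw [norm_smul, Real.norm_of_nonneg χ.nonneg]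
      exact mul_le_of_le_one_left (norm_nonneg x) χ.le_one
    obtain ⟨f, hf0, hf⟩ := exists_solution_Icc (v := fun t x => P t * h x) (K := M * K)
      (M := M * B.toNNReal) hT
      (fun t ht => LipschitzWith.of_dist_le_mul fun x y => by
        rw [dist_eq_norm, ← mul_sub, NNReal.coe_mul, mul_assoc]
        refine (norm_mul_le _ _).trans ?_
        have := hK.dist_le_mul x y
        rw [dist_eq_norm] at this
        gcongr
        exact hM t ht)
      (fun x => (hP.mono Icc_subset_Ici_self).mul continuousOn_const)
      (fun t ht x => by
        refine (norm_mul_le _ _).trans ?_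
        push_cast
        gcongr
        · exact hM t ht
        · exact (hB x).trans (Real.le_coe_toNNReal B)) 1
    have hbound : ∀ t ∈ Icc 0 T, ‖f t‖ ≤ ρ := by
      intro t ht
      have := norm_le_gronwallBound_of_norm_deriv_right_le (f := f) (δ := ‖(1 : R)‖) (K := M)
        (ε := 0) (a := 0) (b := T) (fun t ht => (hf t ht).continuousWithinAt)
        (fun t ht => hasDerivWithinAt_Ici_of_Icc_zero ht (hf t (Ico_subset_Icc_self ht)))
        (by rw [hf0]) (fun t ht => by
          rw [add_zero]
          refine (norm_mul_le _ _).trans ?_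
          gcongr
          · exact hM t (Ico_subset_Icc_self ht)
          · exact hle _) t ht
      rw [gronwallBound_ε0] at this
      refine this.trans ?_
      have hM0 : (0 : ℝ) ≤ M := M.2
      simp only [ρ, sub_zero]
      gcongr
      · linarith
      · exact ht.2
    refine ⟨f, hf0, fun t ht => ?_⟩
    have h1 : h (f t) = f t := by
      have : χ (f t) = 1 := χ.one_of_mem_closedBall (by simpa using hbound t ht)
      simp [h, this]
    simpa [h1] using hf t ht

/-- A solution of `Y' = P Y`, `Y(0) = 1` is the left product integral of `P`. -/
lemma isLeftProductIntegral_of_hasDerivWithinAt {d : ℕ} {P Y : ℝ → Matrix (Fin d) (Fin d) ℝ}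
    (hP : ContinuousOn P (Ici 0)) (h0 : Y 0 = 1)
    (hY : ∀ t, 0 ≤ t → HasDerivWithinAt Y (P t * Y t) (Ici 0) t) {t : ℝ} (ht : 0 ≤ t) :
    IsLeftProductIntegral P 0 t (Y t) := by
  obtain ⟨M, hM⟩ := isCompact_Icc.exists_bound_of_continuousOn
      (hP.mono (Icc_subset_Ici_self : Icc 0 t ⊆ Ici 0))
  have hM0 : 0 ≤ M := (norm_nonneg _).trans (hM 0 ⟨le_rfl, ht⟩)
  have hYc : ContinuousOn Y (Icc 0 t) :=
    fun s hs => ((hY s hs.1).continuousWithinAt).mono Icc_subset_Ici_self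
  have hPY : ContinuousOn (fun s => P s * Y s) (Icc 0 t) :=
    (hP.mono Icc_subset_Ici_self).mul hYc
  have huc := Metric.uniformContinuousOn_iff.1
    (isCompact_Icc.uniformContinuousOn_of_continuous hPY)
  intro η hη
  have hc : 0 < (t + 1) * Real.exp (M * t) := by positivity
  -- Allowed variation of Y' = P Y over one step. With `t + 1` in place of `t` the division is
  -- legitimate at t = 0 and the final inequality is strict.
  set η' := η / ((t + 1) * Real.exp (M * t)) with hη'
  have hη'0 : 0 < η' := by positivity
  obtain ⟨δ, hδ, hδ'⟩ := huc η' hη'0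
  refine ⟨δ, hδ, fun N x ⟨hx0, hxN, hx⟩ => ?_⟩
  have hmem : ∀ j ≤ N, 0 ≤ x j := by
    intro j
    induction j with
    | zero => intro _; rw [hx0]
    | succ j ih => intro hj; exact (ih (by omega)).trans (hx j (by omega)).1.le
  have hmem' : ∀ j ≤ N, x j ≤ t := by
    intro j hj
    induction hj using Nat.decreasingInduction with
    | self => rw [hxN]
    | of_succ k hk ih => exact (hx k hk).1.le.trans ih
  -- The products are the Euler scheme for Y' = P Y. Each step adds a local error at most `η' * D`
  -- and multiplies the old error by at most exp(M·D).
  have key : ∀ j ≤ N, ‖leftProduct P x j - Y (x j)‖ ≤ η' * x j * Real.exp (M * x j) := by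
    intro j
    induction j with
    | zero => intro _; simp [leftProduct, hx0, h0]
    | succ j ih =>
      intro hj
      have hj' : j < N := by omega
      have ih := ih hj'.le
      obtain ⟨hlt, hmesh⟩ := hx j hj'
      have hxj := hmem j hj'.le
      have hxj1 := hmem' (j + 1) hj
      set D := x (j + 1) - x j with hD
      have hD0 : 0 < D := by linarith
      have hr : ‖Y (x (j + 1)) - Y (x j) - D • (P (x j) * Y (x j))‖ ≤ η' * D := by
        have := norm_image_sub_le_of_norm_deriv_right_le_segment
          (f := fun s => Y s - s • (P (x j) * Y (x j)))
          (f' := fun s => P s * Y s - (1 : ℝ) • (P (x j) * Y (x j))) (C := η')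
          (a := x j) (b := x (j + 1))
          (fun s hs => ((hYc s ⟨hxj.trans hs.1, hs.2.trans hxj1⟩).mono
            (Icc_subset_Icc hxj hxj1)).sub (by fun_prop))
          (fun s hs => (((hY s (hxj.trans hs.1)).mono (Ici_subset_Ici.2 (hxj.trans hs.1)))).sub
            ((hasDerivWithinAt_id s (Ici s)).smul_const _))
          (fun s hs => by
            rw [one_smul, ← dist_eq_norm]
            refine (hδ' s ⟨hxj.trans hs.1, hs.2.le.trans hxj1⟩ (x j) ⟨hxj, hmem' j hj'.le⟩ ?_).le
            rw [Real.dist_eq, abs_of_nonneg (by linarith [hs.1])]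
            linarith [hs.2]) (x (j + 1)) ⟨hlt.le, le_rfl⟩
        have e : Y (x (j + 1)) - Y (x j) - D • (P (x j) * Y (x j)) =
            Y (x (j + 1)) - x (j + 1) • (P (x j) * Y (x j)) -
              (Y (x j) - x j • (P (x j) * Y (x j))) := by
          rw [hD, sub_smul]
          abel
        rw [e]
        exact this
      have hfac : ‖(1 : Matrix (Fin d) (Fin d) ℝ) + D • P (x j)‖ ≤ Real.exp (M * D) := by
        have h1 : ‖(1 : Matrix (Fin d) (Fin d) ℝ)‖ ≤ 1 := by
          rw [← Matrix.diagonal_one, Matrix.l2_opNorm_diagonal]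
          exact (pi_norm_le_iff_of_nonneg zero_le_one).2 (fun i => by simp)
        have h2 : ‖D • P (x j)‖ ≤ M * D := by
          rw [norm_smul, Real.norm_of_nonneg hD0.le, mul_comm]
          gcongr
          exact hM _ ⟨hxj, hmem' j hj'.le⟩
        linarith [norm_add_le (1 : Matrix (Fin d) (Fin d) ℝ) (D • P (x j)),
          Real.add_one_le_exp (M * D)]
      have hsplit : leftProduct P x (j + 1) - Y (x (j + 1)) =
          (1 + D • P (x j)) * (leftProduct P x j - Y (x j)) -
            (Y (x (j + 1)) - Y (x j) - D • (P (x j) * Y (x j))) := by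
        simp only [leftProduct, mul_sub, add_mul, one_mul, smul_mul_assoc]
        abel
      rw [hsplit]
      calc _ ≤ Real.exp (M * D) * (η' * x j * Real.exp (M * x j)) + η' * D := by
            refine (norm_sub_le _ _).trans (add_le_add ((norm_mul_le _ _).trans ?_) hr)
            gcongr
        _ = η' * x j * Real.exp (M * x (j + 1)) + η' * D := by
            rw [show M * x (j + 1) = M * D + M * x j by rw [hD]; ring, Real.exp_add]
            ring
        _ ≤ η' * x j * Real.exp (M * x (j + 1)) + η' * D * Real.exp (M * x (j + 1)) := by
            have : 1 ≤ Real.exp (M * x (j + 1)) :=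
              Real.one_le_exp (mul_nonneg hM0 (hmem _ hj))
            linarith [mul_le_mul_of_nonneg_left this (mul_nonneg hη'0.le hD0.le)]
        _ = _ := by rw [hD]; ring
  have := key N le_rfl
  rw [hxN] at this
  refine this.trans_lt ?_
  rw [show η = η' * ((t + 1) * Real.exp (M * t)) by rw [hη']; field_simp]
  rw [mul_assoc]
  gcongr
  linarith

lemma leftProduct_transpose {d : ℕ} {P : ℝ → Matrix (Fin d) (Fin d) ℝ}
    (hP : ∀ t, (P t)ᵀ = P t) (x : ℕ → ℝ) (N : ℕ) :
    (leftProduct P x N)ᵀ = rightProduct P x N := by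
  induction N with
  | zero => simp [leftProduct, rightProduct]
  | succ N ih => simp [leftProduct, rightProduct, Matrix.transpose_mul, ih, hP]

lemma norm_transpose {p q : ℕ} (X : Matrix (Fin p) (Fin q) ℝ) : ‖Xᵀ‖ = ‖X‖ := by
  rw [← Matrix.l2_opNorm_conjTranspose X, Matrix.conjTranspose_eq_transpose_of_trivial]

/-- For symmetric integrands the right product integral is the transpose of the left one. -/
lemma IsLeftProductIntegral.transpose {d : ℕ} {P : ℝ → Matrix (Fin d) (Fin d) ℝ} {a b : ℝ}
    {Y : Matrix (Fin d) (Fin d) ℝ} (h : IsLeftProductIntegral P a b Y)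
    (hP : ∀ t, (P t)ᵀ = P t) : IsRightProductIntegral P a b Yᵀ := by
  intro η hη
  obtain ⟨δ, hδ, H⟩ := h η hη
  refine ⟨δ, hδ, fun N x hx => ?_⟩
  rw [← leftProduct_transpose hP, ← Matrix.transpose_sub, norm_transpose]
  exact H N x hx

end OperatorScaling
namespace OperatorScaling

open Set Filter Topology Matrix

/-! ### The Euclidean operator norm through bilinear and quadratic forms. -/

section Norms

variable {p q r : ℕ}

lemma dotProduct_le_norm (x y : Fin p → ℝ) :
    x ⬝ᵥ y ≤ ‖WithLp.toLp 2 x‖ * ‖WithLp.toLp 2 y‖ := by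
  have := real_inner_le_norm (WithLp.toLp 2 y) (WithLp.toLp 2 x)
  rw [mul_comm]
  simpa [EuclideanSpace.inner_toLp_toLp] using this

lemma norm_toLp_sq (x : Fin p → ℝ) : ‖WithLp.toLp 2 x‖ ^ 2 = x ⬝ᵥ x := by
  rw [EuclideanSpace.norm_sq_eq]
  simp [dotProduct, sq]

lemma norm_mulVec_le (M : Matrix (Fin p) (Fin q) ℝ) (x : Fin q → ℝ) :
    ‖WithLp.toLp 2 (M *ᵥ x)‖ ≤ ‖M‖ * ‖WithLp.toLp 2 x‖ :=
  Matrix.l2_opNorm_mulVec M (WithLp.toLp 2 x)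

lemma norm_le_of_norm_mulVec_le {M : Matrix (Fin p) (Fin q) ℝ} {c : ℝ} (hc : 0 ≤ c)
    (h : ∀ x, ‖WithLp.toLp 2 (M *ᵥ x)‖ ≤ c * ‖WithLp.toLp 2 x‖) : ‖M‖ ≤ c := by
  rw [Matrix.l2_opNorm_def]
  exact ContinuousLinearMap.opNorm_le_bound _ hc fun x => h x.ofLp

lemma norm_le_of_dotProduct_le {M : Matrix (Fin p) (Fin q) ℝ} {c : ℝ} (hc : 0 ≤ c)
    (h : ∀ x y, x ⬝ᵥ M *ᵥ y ≤ c * (‖WithLp.toLp 2 x‖ * ‖WithLp.toLp 2 y‖)) : ‖M‖ ≤ c := by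
  refine norm_le_of_norm_mulVec_le hc fun y => ?_
  have h1 := h (M *ᵥ y) y
  rw [← norm_toLp_sq] at h1
  rcases (norm_nonneg (WithLp.toLp 2 (M *ᵥ y))).eq_or_lt with h0 | h0
  · rw [← h0]; positivity
  · refine le_of_mul_le_mul_left ?_ h0
    linarith

/-- A symmetric matrix whose quadratic form is bounded by `c` has operator norm at most `c`. -/
lemma norm_le_of_abs_quadratic_le {M : Matrix (Fin p) (Fin p) ℝ} {c : ℝ} (hc : 0 ≤ c)
    (hM : Mᵀ = M) (h : ∀ x, |x ⬝ᵥ M *ᵥ x| ≤ c * (x ⬝ᵥ x)) : ‖M‖ ≤ c := by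
  have comm : ∀ x y, x ⬝ᵥ M *ᵥ y = y ⬝ᵥ M *ᵥ x := fun x y => by
    rw [dotProduct_mulVec, ← mulVec_transpose, hM, dotProduct_comm]
  -- Polarization: the forms at x + y and x - y are subtracted.
  have key : ∀ x y, 2 * (x ⬝ᵥ M *ᵥ y) ≤ c * (x ⬝ᵥ x + y ⬝ᵥ y) := fun x y => by
    have h1 := (abs_le.1 (h (x + y))).2
    have h2 := (abs_le.1 (h (x - y))).1
    have h3 := comm x y
    have h4 := dotProduct_comm x y
    simp only [mulVec_add, mulVec_sub, add_dotProduct, sub_dotProduct, dotProduct_add,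
      dotProduct_sub] at h1 h2
    nlinarith
  refine norm_le_of_dotProduct_le hc fun x y => ?_
  rcases (norm_nonneg (WithLp.toLp 2 x)).eq_or_lt with hx | hx
  · have : x = 0 := by simpa using hx.symm
    simp [this]
  rcases (norm_nonneg (WithLp.toLp 2 y)).eq_or_lt with hy | hy
  · have : y = 0 := by simpa using hy.symm
    simp [this]
  -- Rescaling to vectors of equal norm turns the arithmetic mean in `key` into the product of the
  -- norms.
  have h1 := key (‖WithLp.toLp 2 y‖ • x) (‖WithLp.toLp 2 x‖ • y)
  simp only [mulVec_smul, smul_dotProduct, dotProduct_smul, smul_eq_mul, ← norm_toLp_sq] at h1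
  refine le_of_mul_le_mul_left ?_ (mul_pos hx hy)
  linarith

lemma norm_one_le (p : ℕ) : ‖(1 : Matrix (Fin p) (Fin p) ℝ)‖ ≤ 1 :=
  norm_le_of_norm_mulVec_le zero_le_one fun x => by simp

end Norms

/-! ### The Frobenius norm and its comparison with the operator norm. -/

section Frobenius

variable {p q r : ℕ}

/-- A matrix as a vector of the Euclidean space of its entries, whose norm is the
Frobenius norm. -/
noncomputable def vec : Matrix (Fin p) (Fin q) ℝ →ₗ[ℝ] EuclideanSpace ℝ (Fin p × Fin q) where
  toFun X := WithLp.toLp 2 fun z => X z.1 z.2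
  map_add' _ _ := rfl
  map_smul' _ _ := rfl

lemma vec_apply (X : Matrix (Fin p) (Fin q) ℝ) (z : Fin p × Fin q) : vec X z = X z.1 z.2 := rfl

lemma norm_vec_sq (X : Matrix (Fin p) (Fin q) ℝ) : ‖vec X‖ ^ 2 = ∑ a, ∑ b, X a b ^ 2 := by
  simp [EuclideanSpace.norm_sq_eq, vec_apply, Fintype.sum_prod_type]

lemma inner_vec (X Y : Matrix (Fin p) (Fin q) ℝ) :
    inner ℝ (vec X) (vec Y) = ∑ a, ∑ b, X a b * Y a b := by
  simp [PiLp.inner_apply, vec_apply, Fintype.sum_prod_type, mul_comm]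

lemma inner_vec_eq_trace (X Y : Matrix (Fin p) (Fin q) ℝ) :
    inner ℝ (vec X) (vec Y) = (X * Yᵀ).trace := by
  simp [inner_vec, Matrix.trace, Matrix.mul_apply]

lemma norm_vec_transpose (X : Matrix (Fin p) (Fin q) ℝ) : ‖vec Xᵀ‖ = ‖vec X‖ := by
  rw [← sq_eq_sq₀ (norm_nonneg _) (norm_nonneg _), norm_vec_sq, norm_vec_sq, Finset.sum_comm]
  rfl

lemma vec_eq_zero {X : Matrix (Fin p) (Fin q) ℝ} : vec X = 0 ↔ X = 0 := by
  refine ⟨fun h => ?_, fun h => by rw [h, map_zero]⟩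
  ext a b
  exact congrArg (fun v => v.ofLp (a, b)) h

lemma norm_vec_sq_eq_sum_col (X : Matrix (Fin p) (Fin q) ℝ) :
    ‖vec X‖ ^ 2 = ∑ b, ‖WithLp.toLp 2 (X *ᵥ Pi.single b 1)‖ ^ 2 := by
  rw [norm_vec_sq, Finset.sum_comm]
  simp [EuclideanSpace.norm_sq_eq]

lemma norm_vec_mul_le (P : Matrix (Fin p) (Fin q) ℝ) (X : Matrix (Fin q) (Fin r) ℝ) :
    ‖vec (P * X)‖ ≤ ‖P‖ * ‖vec X‖ := by
  rw [← sq_le_sq₀ (norm_nonneg _) (by positivity), mul_pow, norm_vec_sq_eq_sum_col,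
    norm_vec_sq_eq_sum_col, Finset.mul_sum]
  gcongr with b
  rw [← mul_pow, ← mulVec_mulVec]
  gcongr
  exact norm_mulVec_le _ _

lemma norm_vec_mul_le' (X : Matrix (Fin p) (Fin q) ℝ) (P : Matrix (Fin q) (Fin r) ℝ) :
    ‖vec (X * P)‖ ≤ ‖vec X‖ * ‖P‖ := by
  rw [← norm_vec_transpose, Matrix.transpose_mul, ← norm_transpose P, ← norm_vec_transpose X,
    mul_comm]
  exact norm_vec_mul_le _ _

lemma norm_vec_sq_le (X : Matrix (Fin p) (Fin q) ℝ) : ‖vec X‖ ^ 2 ≤ q * ‖X‖ ^ 2 := by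
  rw [norm_vec_sq_eq_sum_col]
  refine (Finset.sum_le_sum (g := fun _ => ‖X‖ ^ 2) fun b _ => ?_).trans (by simp)
  gcongr
  refine (norm_mulVec_le _ _).trans ?_
  simp

lemma norm_le_norm_vec (X : Matrix (Fin p) (Fin q) ℝ) : ‖X‖ ≤ ‖vec X‖ := by
  refine norm_le_of_norm_mulVec_le (norm_nonneg _) fun x => ?_
  rw [← sq_le_sq₀ (norm_nonneg _) (by positivity), mul_pow, norm_vec_sq,
    EuclideanSpace.norm_sq_eq, EuclideanSpace.norm_sq_eq, Finset.sum_mul]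
  gcongr with a
  simpa [mulVec, dotProduct] using Finset.sum_mul_sq_le_sq_mul_sq Finset.univ (X a) x

end Frobenius

/-! ### The completely positive map, its norm and the error matrices. -/

section CPMap

variable {m n k : ℕ} (A : Fin k → Matrix (Fin m) (Fin n) ℝ)

/-- The completely positive map `X ↦ ∑ i, A i * X * (A i)ᵀ` of an operator. -/
noncomputable def cpMap (X : Matrix (Fin n) (Fin n) ℝ) : Matrix (Fin m) (Fin m) ℝ :=
  ∑ i, A i * X * (A i)ᵀ

lemma cpMap_one : cpMap A 1 = leftGram A := by simp [cpMap, leftGram]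

/-- Transposing every `A i` exchanges left and right; facts about the right error matrix are deduced
in this way from those about the left one. -/
lemma leftGram_transpose_operator : leftGram (fun i => (A i)ᵀ) = rightGram A := by
  simp [leftGram, rightGram]

lemma rightGram_transpose_operator : rightGram (fun i => (A i)ᵀ) = leftGram A := by
  simp [leftGram, rightGram]

lemma size_eq_sum_norm_vec : size A = ∑ i, ‖vec (A i)‖ ^ 2 := by
  simp [size, norm_vec_sq]

lemma size_transpose_operator : size (fun i => (A i)ᵀ) = size A := by
  simp [size_eq_sum_norm_vec, norm_vec_transpose]

lemma size_nonneg : 0 ≤ size A := by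
  rw [size_eq_sum_norm_vec]; positivity

lemma errorE_transpose_operator : errorE (fun i => (A i)ᵀ) = errorF A := by
  simp [errorE, errorF, size_transpose_operator, leftGram_transpose_operator]

lemma errorF_transpose_operator : errorF (fun i => (A i)ᵀ) = errorE A := by
  simp [errorE, errorF, size_transpose_operator, rightGram_transpose_operator]

lemma leftGram_transpose : (leftGram A)ᵀ = leftGram A := by
  simp [leftGram, Matrix.transpose_sum, Matrix.transpose_mul]

lemma errorE_transpose : (errorE A)ᵀ = errorE A := by
  simp [errorE, leftGram_transpose]

lemma errorF_transpose : (errorF A)ᵀ = errorF A := by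
  rw [← errorE_transpose_operator, errorE_transpose]

lemma trace_leftGram : (leftGram A).trace = size A := by
  simp only [leftGram, Matrix.trace_sum, ← inner_vec_eq_trace, inner_vec, size, sq]

lemma trace_errorE : (errorE A).trace = 0 := by
  simp [errorE, Matrix.trace_sub, trace_leftGram, mul_comm]

lemma trace_errorF : (errorF A).trace = 0 := by
  rw [← errorE_transpose_operator, trace_errorE]

lemma sum_norm_transpose_mulVec_sq (x : Fin m → ℝ) :
    ∑ i, ‖WithLp.toLp 2 ((A i)ᵀ *ᵥ x)‖ ^ 2 = x ⬝ᵥ leftGram A *ᵥ x := by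
  simp only [leftGram, Matrix.sum_mulVec, dotProduct_sum, norm_toLp_sq]
  refine Finset.sum_congr rfl fun i _ => ?_
  rw [← mulVec_mulVec, dotProduct_mulVec x, ← mulVec_transpose]

/-- A positive map attains its norm at the identity. Here this is Cauchy–Schwarz over i for the
vectors (A i)ᵀx and (A i)ᵀy, whose squared norms sum to quadratic forms of `leftGram A`. -/
lemma norm_cpMap_le (X : Matrix (Fin n) (Fin n) ℝ) :
    ‖cpMap A X‖ ≤ ‖X‖ * ‖leftGram A‖ := by
  have hG : ∀ x : Fin m → ℝ, √(∑ i, ‖WithLp.toLp 2 ((A i)ᵀ *ᵥ x)‖ ^ 2) ≤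
      √‖leftGram A‖ * ‖WithLp.toLp 2 x‖ := fun x => by
    rw [sum_norm_transpose_mulVec_sq, ← Real.sqrt_sq (norm_nonneg (WithLp.toLp 2 x)),
      ← Real.sqrt_mul (norm_nonneg _)]
    apply Real.sqrt_le_sqrt
    refine (dotProduct_le_norm _ _).trans ?_
    nlinarith [norm_mulVec_le (leftGram A) x, norm_nonneg (WithLp.toLp 2 x)]
  refine norm_le_of_dotProduct_le (by positivity) fun x y => ?_
  calc x ⬝ᵥ cpMap A X *ᵥ y
      = ∑ i, ((A i)ᵀ *ᵥ x) ⬝ᵥ X *ᵥ ((A i)ᵀ *ᵥ y) := by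
        simp only [cpMap, Matrix.sum_mulVec, dotProduct_sum]
        refine Finset.sum_congr rfl fun i _ => ?_
        rw [← mulVec_mulVec, ← mulVec_mulVec, dotProduct_mulVec x, ← mulVec_transpose]
    _ ≤ ∑ i, ‖X‖ * (‖WithLp.toLp 2 ((A i)ᵀ *ᵥ x)‖ * ‖WithLp.toLp 2 ((A i)ᵀ *ᵥ y)‖) := by
        refine Finset.sum_le_sum fun i _ => (dotProduct_le_norm _ _).trans ?_
        nlinarith [norm_mulVec_le X ((A i)ᵀ *ᵥ y), norm_nonneg (WithLp.toLp 2 ((A i)ᵀ *ᵥ x))]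
    _ ≤ ‖X‖ * (√(∑ i, ‖WithLp.toLp 2 ((A i)ᵀ *ᵥ x)‖ ^ 2) *
          √(∑ i, ‖WithLp.toLp 2 ((A i)ᵀ *ᵥ y)‖ ^ 2)) := by
        rw [← Finset.mul_sum]
        gcongr
        exact Real.sum_mul_le_sqrt_mul_sqrt _ _ _
    _ ≤ ‖X‖ * ((√‖leftGram A‖ * ‖WithLp.toLp 2 x‖) * (√‖leftGram A‖ * ‖WithLp.toLp 2 y‖)) := by
        gcongr <;> exact hG _
    _ = _ := by
        rw [show ∀ a b c d : ℝ, a * ((b * c) * (b * d)) = a * (b * b) * (c * d) by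
          intros; ring, Real.mul_self_sqrt (norm_nonneg _)]

lemma smul_leftGram : (m : ℝ) • leftGram A = size A • 1 - errorE A := by
  simp [errorE]

/-- The bound carries no dimension factor: to first order m‖Φ(X)‖ is at most s‖X‖, which is what the
damping -2s in the error equations can absorb. -/
lemma norm_cpMap_le_size (X : Matrix (Fin n) (Fin n) ℝ) :
    m * ‖cpMap A X‖ ≤ ‖X‖ * (size A + ‖errorE A‖) := by
  have h1 : m * ‖leftGram A‖ ≤ size A + ‖errorE A‖ := by
    have h2 : m * ‖leftGram A‖ = ‖(m : ℝ) • leftGram A‖ := by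
      rw [norm_smul]; simp
    rw [h2, smul_leftGram]
    refine (norm_sub_le _ _).trans ?_
    gcongr
    rw [norm_smul, Real.norm_of_nonneg (size_nonneg A)]
    exact mul_le_of_le_one_right (size_nonneg A) (norm_one_le m)
  calc m * ‖cpMap A X‖ ≤ m * (‖X‖ * ‖leftGram A‖) := by gcongr; exact norm_cpMap_le A X
    _ = ‖X‖ * (m * ‖leftGram A‖) := by ring
    _ ≤ _ := by gcongr

variable {A}

lemma IsNearlyDoublyBalanced.transpose {ε : ℝ} (h : IsNearlyDoublyBalanced ε A) :
    IsNearlyDoublyBalanced ε (fun i => (A i)ᵀ) := by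
  obtain ⟨h1, h2, h3, h4⟩ := h
  refine ⟨?_, ?_, ?_, ?_⟩ <;>
    simpa only [size_transpose_operator, leftGram_transpose_operator,
      rightGram_transpose_operator]

lemma IsNearlyDoublyBalanced.norm_errorE_le {ε : ℝ} (hε : 0 ≤ ε) (hm : 0 < m)
    (h : IsNearlyDoublyBalanced ε A) : ‖errorE A‖ ≤ ε * size A := by
  obtain ⟨h1, h2, -, -⟩ := h
  have hm' : (0 : ℝ) < m := by exact_mod_cast hm
  refine norm_le_of_abs_quadratic_le (mul_nonneg hε (size_nonneg A)) (errorE_transpose A)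
    fun x => ?_
  have h1 := h1.dotProduct_mulVec_nonneg x
  have h2 := h2.dotProduct_mulVec_nonneg x
  simp only [errorE, sub_mulVec, smul_mulVec, one_mulVec, dotProduct_sub, dotProduct_smul,
    star_trivial, smul_eq_mul] at h1 h2 ⊢
  have h1 := mul_nonneg hm'.le h1
  have h2 := mul_nonneg hm'.le h2
  have e1 : ∀ u v w : ℝ, m * (v - u * (size A / m) * w) = m * v - u * size A * w := by
    intros; field_simp
  have e2 : ∀ u v w : ℝ, m * (u * (size A / m) * w - v) = u * size A * w - m * v := by
    intros; field_simp
  rw [e1] at h1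
  rw [e2] at h2
  rw [abs_le]
  constructor <;> linarith

lemma isDoublyBalanced_of_error_eq_zero (hm : 0 < m) (hn : 0 < n) (hE : errorE A = 0)
    (hF : errorF A = 0) : IsDoublyBalanced A := by
  have hm' : (m : ℝ) ≠ 0 := by exact_mod_cast hm.ne'
  have hn' : (n : ℝ) ≠ 0 := by exact_mod_cast hn.ne'
  have h1 : leftGram A = (size A / m) • 1 := by
    have := smul_leftGram A
    rw [hE, sub_zero] at this
    rw [div_eq_inv_mul, ← smul_smul, ← this, smul_smul, inv_mul_cancel₀ hm', one_smul]
  have h2 : rightGram A = (size A / n) • 1 := by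
    have := smul_leftGram (fun i => (A i)ᵀ)
    rw [errorE_transpose_operator, hF, sub_zero, leftGram_transpose_operator,
      size_transpose_operator] at this
    rw [div_eq_inv_mul, ← smul_smul, ← this, smul_smul, inv_mul_cancel₀ hn', one_smul]
  refine ⟨?_, ?_, ?_, ?_⟩ <;> simp [h1, h2, Matrix.PosSemidef.zero]

end CPMap

end OperatorScaling
namespace OperatorScaling

open Set Filter Topology Matrix

/-! ### Second singular value and nearly singular pairs of vectors. -/

section SingularValues

variable {V W : Type*} [NormedAddCommGroup V] [InnerProductSpace ℝ V] [FiniteDimensional ℝ V]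
  [NormedAddCommGroup W] [InnerProductSpace ℝ W] [FiniteDimensional ℝ W]

open Module in
/-- There is an orthonormal basis of right singular vectors. -/
lemma exists_orthonormalBasis_singularValues (T : V →ₗ[ℝ] W) :
    ∃ b : OrthonormalBasis (Fin (finrank ℝ V)) ℝ V,
      ∀ y, ‖T y‖ ^ 2 = ∑ i : Fin (finrank ℝ V), T.singularValues i.1 ^ 2 * inner ℝ (b i) y ^ 2 := by
  have hT := T.isSymmetric_adjoint_comp_self
  refine ⟨hT.eigenvectorBasis rfl, fun y => ?_⟩
  set b := hT.eigenvectorBasis rfl with hb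
  have h1 : ‖T y‖ ^ 2 = inner ℝ y ((LinearMap.adjoint T ∘ₗ T) y) := by
    rw [LinearMap.comp_apply, LinearMap.adjoint_inner_right, real_inner_self_eq_norm_sq]
  rw [h1, ← b.sum_inner_mul_inner]
  refine Finset.sum_congr rfl fun i _ => ?_
  rw [← hT (b i) y, hb, hT.apply_eigenvectorBasis rfl i, T.sq_singularValues_fin rfl i,
    real_inner_smul_left, real_inner_comm]
  simp only [RCLike.ofReal_real_eq_id, id_eq]
  ring

open Module in
lemma exists_norm_eq_singularValues (T : V →ₗ[ℝ] W) {j : ℕ} (hj : j < finrank ℝ V) :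
    ∃ v : V, ‖v‖ = 1 ∧ ‖T v‖ = T.singularValues j := by
  obtain ⟨b, hb⟩ := exists_orthonormalBasis_singularValues T
  refine ⟨b ⟨j, hj⟩, b.norm_eq_one _, ?_⟩
  rw [← sq_eq_sq₀ (norm_nonneg _) (T.singularValues_nonneg j), hb,
    Finset.sum_eq_single ⟨j, hj⟩]
  · simp
  · intro i _ hi
    simp [b.inner_eq_ite, hi]
  · simp

/-- Every plane contains a unit vector that `T` stretches by at most the second largest
singular value. -/
lemma exists_norm_le_singularValues_one (T : V →ₗ[ℝ] W) {u x : V} (hu : ‖u‖ = 1) (hx : ‖x‖ = 1)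
    (hux : inner ℝ u x = 0) :
    ∃ a b : ℝ, a ^ 2 + b ^ 2 = 1 ∧ ‖T (a • u + b • x)‖ ≤ T.singularValues 1 := by
  obtain ⟨e, he⟩ := exists_orthonormalBasis_singularValues T
  have hnorm : ∀ a b : ℝ, ‖a • u + b • x‖ ^ 2 = a ^ 2 + b ^ 2 := fun a b => by
    rw [norm_add_sq_real, norm_smul, norm_smul, hu, hx, inner_smul_left, inner_smul_right, hux]
    simp
  have hpos : 0 < Module.finrank ℝ V := by
    have : Nontrivial V := ⟨u, 0, by rintro rfl; simp at hu⟩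
    exact Module.finrank_pos
  -- A plane meets the hyperplane orthogonal to the top right singular vector; on that hyperplane
  -- `T` stretches by at most the second singular value.
  obtain ⟨a, b, hab, h0⟩ : ∃ a b : ℝ, a ^ 2 + b ^ 2 = 1 ∧
      inner ℝ (e ⟨0, hpos⟩) (a • u + b • x) = 0 := by
    set α := inner ℝ (e ⟨0, hpos⟩) u with hα
    set β := inner ℝ (e ⟨0, hpos⟩) x with hβ
    rcases eq_or_ne (α ^ 2 + β ^ 2) 0 with h | h
    · have : α = 0 := by nlinarith [sq_nonneg α, sq_nonneg β]
      exact ⟨1, 0, by norm_num, by simp [← hα, this]⟩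
    · have h' : 0 < α ^ 2 + β ^ 2 := lt_of_le_of_ne (by positivity) h.symm
      have hs := Real.sq_sqrt h'.le
      have hs0 := Real.sqrt_pos.2 h'
      refine ⟨β / √(α ^ 2 + β ^ 2), -α / √(α ^ 2 + β ^ 2), ?_, ?_⟩
      · rw [div_pow, div_pow, hs]
        field_simp
        ring
      · rw [inner_add_right, inner_smul_right, inner_smul_right, ← hα, ← hβ]
        ring
  refine ⟨a, b, hab, ?_⟩
  rw [← sq_le_sq₀ (norm_nonneg _) (T.singularValues_nonneg 1), he,
    ← mul_one (T.singularValues 1 ^ 2), ← hab, ← hnorm, ← e.sum_sq_inner_right, Finset.mul_sum]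
  refine Finset.sum_le_sum fun (i : Fin (Module.finrank ℝ V)) _ => ?_
  rcases Nat.eq_zero_or_pos i.1 with hi | hi
  · have : i = ⟨0, hpos⟩ := Fin.ext hi
    rw [this, h0]
    simp
  · gcongr
    · exact T.singularValues_nonneg i
    · exact T.singularValues_antitone hi

/-- If `u`, `w` are nearly a pair of singular vectors with singular value `c`, and the second
largest singular value of `T` is at most `(1 - lam) c`, then `T` is small on `uᗮ × wᗮ`. -/
lemma inner_le_of_singularValues_one_le (T : V →ₗ[ℝ] W) {u : V} {w : W} {c ε lam : ℝ}
    (hu : ‖u‖ = 1) (hw : ‖w‖ = 1) (hc : 0 < c) (hε : 0 ≤ ε) (hlam : ε < lam)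
    (huw : inner ℝ w (T u) = c) (h1 : ‖T u - c • w‖ ≤ ε * c)
    (h2 : ∀ x, inner ℝ u x = 0 → |inner ℝ w (T x)| ≤ ε * c * ‖x‖)
    (hgap : T.singularValues 1 ≤ (1 - lam) * c) {x : V} {y : W} (hx : inner ℝ u x = 0)
    (hy : inner ℝ w y = 0) :
    inner ℝ y (T x) ≤ (1 - lam + ε) * c * (‖x‖ * ‖y‖) := by
  have hw2 : inner ℝ w w = (1 : ℝ) := by rw [real_inner_self_eq_norm_sq, hw]; norm_num
  have hmu : 0 ≤ (1 - lam + ε) * c := by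
    nlinarith [T.singularValues_nonneg 1]
  have unit : ∀ x : V, ‖x‖ = 1 → inner ℝ u x = 0 →
      ‖T x - (inner ℝ w (T x) : ℝ) • w‖ ≤ (1 - lam + ε) * c := by
    intro x hx1 hx
    by_contra! hcon
    obtain ⟨a, b, hab, hT⟩ := exists_norm_le_singularValues_one T hu hx1 hx
    set β : ℝ := inner ℝ w (T x) with hβ
    set p := T x - β • w with hp
    have hβ' : |β| ≤ ε * c := by simpa [hx1] using h2 x hx
    have hwp : inner ℝ w p = (0 : ℝ) := by
      rw [hp, inner_sub_right, inner_smul_right, hw2, ← hβ]; ring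
    set e := T u - c • w with he
    have hwe : inner ℝ w e = (0 : ℝ) := by
      rw [he, inner_sub_right, inner_smul_right, hw2, huw]; ring
    -- The first bracket is an orthogonal sum whose two parts have lengths |a|c and |b|‖p‖ with c
    -- and ‖p‖ both above (1 - lam + ε)c; the second has length at most εc. Hence every unit vector
    -- of the plane is stretched by more than (1 - lam)c, against the choice of a, b.
    have hsplit : T (a • u + b • x) = ((a * c) • w + b • p) + (a • e + (b * β) • w) := by
      rw [map_add, map_smul, map_smul, hp, he]
      module
    have n1 : ‖(a * c) • w + b • p‖ ^ 2 = a ^ 2 * c ^ 2 + b ^ 2 * ‖p‖ ^ 2 := by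
      rw [norm_add_sq_real, norm_smul, norm_smul, hw, inner_smul_left, inner_smul_right, hwp,
        mul_pow, mul_pow, Real.norm_eq_abs, Real.norm_eq_abs, sq_abs, sq_abs]
      ring
    have n2 : ‖a • e + (b * β) • w‖ ≤ ε * c := by
      rw [← sq_le_sq₀ (norm_nonneg _) (by positivity), norm_add_sq_real, norm_smul, norm_smul, hw,
        inner_smul_left, inner_smul_right, real_inner_comm, hwe, mul_pow, mul_pow,
        Real.norm_eq_abs, Real.norm_eq_abs, sq_abs, sq_abs]
      have b1 : ‖e‖ ^ 2 ≤ (ε * c) ^ 2 := by gcongr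
      have b2 : β ^ 2 ≤ (ε * c) ^ 2 := by rw [← sq_abs β]; gcongr
      nlinarith [mul_le_mul_of_nonneg_left b1 (sq_nonneg a),
        mul_le_mul_of_nonneg_left b2 (sq_nonneg b)]
    have n3 : (1 - lam + ε) * c < ‖(a * c) • w + b • p‖ := by
      rw [← sq_lt_sq₀ hmu (norm_nonneg _), n1]
      have g1 : ((1 - lam + ε) * c) ^ 2 < c ^ 2 := by
        have : (1 - lam + ε) * c < c := by nlinarith
        gcongr
      have g2 : ((1 - lam + ε) * c) ^ 2 < ‖p‖ ^ 2 := by gcongr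
      set μ := ((1 - lam + ε) * c) ^ 2
      rcases eq_or_ne a 0 with rfl | ha
      · nlinarith
      · have := mul_lt_mul_of_pos_left g1 (by positivity : 0 < a ^ 2)
        have := mul_le_mul_of_nonneg_left g2.le (sq_nonneg b)
        nlinarith
    have n4 := norm_sub_le ((a * c) • w + b • p + (a • e + (b * β) • w)) (a • e + (b * β) • w)
    rw [add_sub_cancel_right, ← hsplit] at n4
    linarith
  rcases (norm_nonneg x).eq_or_lt with h0 | h0
  · have : x = 0 := by simpa using h0.symm
    simp [this]
  · have hux := unit (‖x‖⁻¹ • x) (by rw [norm_smul, norm_inv, norm_norm]; field_simp)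
      (by rw [inner_smul_right, hx, mul_zero])
    rw [map_smul, inner_smul_right, mul_smul, ← smul_sub, norm_smul, norm_inv, norm_norm] at hux
    have h3 : ‖T x - (inner ℝ w (T x) : ℝ) • w‖ ≤ (1 - lam + ε) * c * ‖x‖ := by
      rwa [inv_mul_le_iff₀ h0, mul_comm] at hux
    calc inner ℝ y (T x) = inner ℝ y (T x - (inner ℝ w (T x) : ℝ) • w) := by
          rw [inner_sub_right, inner_smul_right, real_inner_comm w y, hy]; simp
      _ ≤ ‖y‖ * ‖T x - (inner ℝ w (T x) : ℝ) • w‖ := real_inner_le_norm _ _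
      _ ≤ ‖y‖ * ((1 - lam + ε) * c * ‖x‖) := by gcongr
      _ = _ := by ring

/-- In the situation of `inner_le_of_singularValues_one_le`, `T` has norm at most `4 c`. -/
lemma inner_le_of_singularValues_one_le' (T : V →ₗ[ℝ] W) {u : V} {w : W} {c ε lam : ℝ}
    (hu : ‖u‖ = 1) (hw : ‖w‖ = 1) (hc : 0 < c) (hε : 0 ≤ ε) (hε1 : ε ≤ 1) (hlam : ε < lam)
    (huw : inner ℝ w (T u) = c) (h1 : ‖T u - c • w‖ ≤ ε * c)
    (h2 : ∀ x, inner ℝ u x = 0 → |inner ℝ w (T x)| ≤ ε * c * ‖x‖)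
    (hgap : T.singularValues 1 ≤ (1 - lam) * c) (x : V) (y : W) :
    inner ℝ y (T x) ≤ 4 * c * (‖x‖ * ‖y‖) := by
  have hw2 : inner ℝ w w = (1 : ℝ) := by rw [real_inner_self_eq_norm_sq, hw]; norm_num
  have hu2 : inner ℝ u u = (1 : ℝ) := by rw [real_inner_self_eq_norm_sq, hu]; norm_num
  set α : ℝ := inner ℝ u x with hα
  set β : ℝ := inner ℝ w y with hβ
  set x' := x - α • u with hx'
  set y' := y - β • w with hy'
  have hux : inner ℝ u x' = (0 : ℝ) := by
    rw [hx', inner_sub_right, inner_smul_right, hu2, ← hα]; ring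
  have hwy : inner ℝ w y' = (0 : ℝ) := by
    rw [hy', inner_sub_right, inner_smul_right, hw2, ← hβ]; ring
  have hx2 : ‖x‖ ^ 2 = α ^ 2 + ‖x'‖ ^ 2 := by
    have : x = α • u + x' := by rw [hx']; abel
    rw [this, norm_add_sq_real, norm_smul, hu, inner_smul_left, hux, mul_pow, Real.norm_eq_abs,
      sq_abs]
    ring
  have hy2 : ‖y‖ ^ 2 = β ^ 2 + ‖y'‖ ^ 2 := by
    have : y = β • w + y' := by rw [hy']; abel
    rw [this, norm_add_sq_real, norm_smul, hw, inner_smul_left, hwy, mul_pow, Real.norm_eq_abs,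
      sq_abs]
    ring
  have bx : ‖x'‖ ≤ ‖x‖ := by
    rw [← sq_le_sq₀ (norm_nonneg _) (norm_nonneg _)]; nlinarith [sq_nonneg α]
  have by' : ‖y'‖ ≤ ‖y‖ := by
    rw [← sq_le_sq₀ (norm_nonneg _) (norm_nonneg _)]; nlinarith [sq_nonneg β]
  have ba : |α| ≤ ‖x‖ := by simpa [hu] using abs_real_inner_le_norm u x
  have bb : |β| ≤ ‖y‖ := by simpa [hw] using abs_real_inner_le_norm w y
  have t1 := inner_le_of_singularValues_one_le T hu hw hc hε hlam huw h1 h2 hgap hux hwy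
  have t2 : inner ℝ y' (T u) ≤ ε * c * ‖y'‖ ∧ -inner ℝ y' (T u) ≤ ε * c * ‖y'‖ := by
    have e : inner ℝ y' (T u) = inner ℝ y' (T u - c • w) := by
      rw [inner_sub_right, inner_smul_right, real_inner_comm w y', hwy]; simp
    have := abs_real_inner_le_norm y' (T u - c • w)
    rw [← e] at this
    have h3 : ‖y'‖ * ‖T u - c • w‖ ≤ ε * c * ‖y'‖ := by
      rw [mul_comm]; gcongr
    exact ⟨(le_abs_self _).trans (this.trans h3), (neg_le_abs _).trans (this.trans h3)⟩
  have t2' : α * inner ℝ y' (T u) ≤ c * (‖x‖ * ‖y‖) := by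
    refine (le_abs_self _).trans ?_
    rw [abs_mul]
    have h3 : |inner ℝ y' (T u)| ≤ ε * c * ‖y'‖ := abs_le'.2 t2
    calc |α| * |inner ℝ y' (T u)| ≤ ‖x‖ * (1 * c * ‖y‖) := by
          gcongr
          exact h3.trans (by gcongr)
      _ = _ := by ring
  have t3' : β * inner ℝ w (T x') ≤ c * (‖x‖ * ‖y‖) := by
    refine (le_abs_self _).trans ?_
    rw [abs_mul]
    calc |β| * |inner ℝ w (T x')| ≤ ‖y‖ * (1 * c * ‖x‖) := by
          gcongr
          exact (h2 _ hux).trans (by gcongr)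
      _ = _ := by ring
  have t4 : α * β * c ≤ c * (‖x‖ * ‖y‖) := by
    have : α * β ≤ ‖x‖ * ‖y‖ := by
      refine (le_abs_self _).trans ?_
      rw [abs_mul]; gcongr
    nlinarith
  have t1' : inner ℝ y' (T x') ≤ c * (‖x‖ * ‖y‖) := by
    refine t1.trans ?_
    calc (1 - lam + ε) * c * (‖x'‖ * ‖y'‖) ≤ 1 * c * (‖x‖ * ‖y‖) := by
          gcongr
          linarith
      _ = _ := by ring
  -- Splitting x along u and y along w gives four terms, each at most c‖x‖‖y‖; their number is the
  -- constant 4.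
  have e : inner ℝ y (T x) = α * β * c + α * inner ℝ y' (T u) + β * inner ℝ w (T x') +
      inner ℝ y' (T x') := by
    have ex : x = α • u + x' := by rw [hx']; abel
    have ey : y = β • w + y' := by rw [hy']; abel
    rw [ex, ey, map_add, map_smul, ← huw]
    simp only [inner_add_left, inner_add_right, inner_smul_left, inner_smul_right]
    simp
    ring
  rw [e]
  linarith

end SingularValues

/-! ### The spectral gap as a bound for the completely positive map on traceless matrices, and its
stability. -/

section Gap

variable {m n k : ℕ} {A : Fin k → Matrix (Fin m) (Fin n) ℝ}

lemma naturalMatrix_vec (A : Fin k → Matrix (Fin m) (Fin n) ℝ) (X : Matrix (Fin n) (Fin n) ℝ) :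
    Matrix.toEuclideanLin (naturalMatrix A) (vec X) = vec (cpMap A X) := by
  ext ⟨a, b⟩
  change (naturalMatrix A *ᵥ fun z => X z.1 z.2) (a, b) = cpMap A X a b
  simp only [naturalMatrix, cpMap, mulVec, dotProduct, Fintype.sum_prod_type, Matrix.sum_apply,
    Matrix.mul_apply, Matrix.transpose_apply, Finset.sum_mul, Matrix.kroneckerMap_apply]
  rw [Finset.sum_congr rfl (fun _ _ => Finset.sum_comm), Finset.sum_comm]
  refine Finset.sum_congr rfl fun i _ => ?_
  rw [Finset.sum_comm]
  refine Finset.sum_congr rfl fun c _ => Finset.sum_congr rfl fun d _ => ?_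
  ring

lemma exists_vec_eq (z : EuclideanSpace ℝ (Fin m × Fin n)) : ∃ X, vec X = z :=
  ⟨fun a b => z (a, b), rfl⟩

lemma inner_vec_one (X : Matrix (Fin n) (Fin n) ℝ) : inner ℝ (vec 1) (vec X) = X.trace := by
  rw [inner_vec_eq_trace, one_mul, trace_transpose]

lemma norm_vec_one (n : ℕ) : ‖vec (1 : Matrix (Fin n) (Fin n) ℝ)‖ = √n := by
  rw [← Real.sqrt_sq (norm_nonneg _), ← real_inner_self_eq_norm_sq, inner_vec_one]
  simp

/-- The adjoint of the map sends the identity to `rightGram A`. -/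
lemma trace_cpMap (A : Fin k → Matrix (Fin m) (Fin n) ℝ) (X : Matrix (Fin n) (Fin n) ℝ) :
    (cpMap A X).trace = inner ℝ (vec (rightGram A)) (vec X) := by
  rw [real_inner_comm, inner_vec_eq_trace, cpMap, rightGram, Matrix.transpose_sum, Matrix.mul_sum,
    Matrix.trace_sum, Matrix.trace_sum]
  refine Finset.sum_congr rfl fun i _ => ?_
  rw [Matrix.mul_assoc, Matrix.trace_mul_comm, Matrix.transpose_mul, Matrix.transpose_transpose,
    Matrix.mul_assoc]

lemma norm_vec_error_le {ε : ℝ} (hε : 0 ≤ ε) (hm : 0 < m)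
    (h : IsNearlyDoublyBalanced ε A) : ‖vec (errorE A)‖ ≤ ε * size A * √m := by
  rw [← sq_le_sq₀ (norm_nonneg _) (by have := size_nonneg A; positivity), mul_pow, Real.sq_sqrt (by positivity)]
  refine (norm_vec_sq_le _).trans ?_
  rw [mul_comm]
  gcongr
  exact h.norm_errorE_le hε hm

/-- The bilinear form of a nearly doubly balanced operator with a spectral gap. -/
lemma inner_cpMap_le {ε lam : ℝ} (hm : 0 < m) (hn : 0 < n) (hs : 0 < size A) (hε : 0 ≤ ε)
    (hε1 : ε ≤ 1) (hlam : ε < lam) (hA : IsNearlyDoublyBalanced ε A) (hgap : HasSpectralGap lam A) :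
    (∀ X Y, X.trace = 0 → Y.trace = 0 → inner ℝ (vec Y) (vec (cpMap A X)) ≤
      (1 - lam + ε) * (size A / √((m : ℝ) * n)) * (‖vec X‖ * ‖vec Y‖)) ∧
    ∀ X Y, inner ℝ (vec Y) (vec (cpMap A X)) ≤
      4 * (size A / √((m : ℝ) * n)) * (‖vec X‖ * ‖vec Y‖) := by
  have hm' : (0 : ℝ) < m := by exact_mod_cast hm
  have hn' : (0 : ℝ) < n := by exact_mod_cast hn
  have hsm : 0 < √(m : ℝ) := Real.sqrt_pos.2 hm'
  have hsn : 0 < √(n : ℝ) := Real.sqrt_pos.2 hn'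
  have hsm2 : √(m : ℝ) * √m = m := Real.mul_self_sqrt hm'.le
  have hsn2 : √(n : ℝ) * √n = n := Real.mul_self_sqrt hn'.le
  rw [Real.sqrt_mul hm'.le]
  unfold HasSpectralGap singularValue at hgap
  rw [Real.sqrt_mul hm'.le] at hgap
  set T := Matrix.toEuclideanLin (naturalMatrix A) with hT
  set c := size A / (√(m : ℝ) * √n) with hc
  have hc0 : 0 < c := by positivity
  -- The normalized identities play the roles of the nearly singular pair. Being orthogonal to them
  -- means having trace zero.
  set u : EuclideanSpace ℝ (Fin n × Fin n) := (√(n : ℝ))⁻¹ • vec 1 with hu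
  set w : EuclideanSpace ℝ (Fin m × Fin m) := (√(m : ℝ))⁻¹ • vec 1 with hw
  have hu1 : ‖u‖ = 1 := by
    rw [hu, norm_smul, norm_vec_one, Real.norm_of_nonneg (by positivity)]
    field_simp
  have hw1 : ‖w‖ = 1 := by
    rw [hw, norm_smul, norm_vec_one, Real.norm_of_nonneg (by positivity)]
    field_simp
  have hTu : T u = (√(n : ℝ))⁻¹ • vec (leftGram A) := by
    rw [hu, map_smul, naturalMatrix_vec, cpMap_one]
  have huw : inner ℝ w (T u) = c := by
    rw [hTu, hw, inner_smul_left, inner_smul_right, inner_vec_one, trace_leftGram, hc]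
    simp
    field_simp
  -- The defect of u is a multiple of E. In `h2` the defect of w is the pairing with a multiple of
  -- F, since the part of `rightGram A` along the identity does not see traceless matrices.
  have h1 : ‖T u - c • w‖ ≤ ε * c := by
    have e : T u - c • w = -((√(n : ℝ))⁻¹ * (m : ℝ)⁻¹) • vec (errorE A) := by
      rw [hTu, hw, errorE, map_sub, map_smul, map_smul, hc]
      generalize √(m : ℝ) = α at hsm hsm2
      rw [← hsm2]
      match_scalars <;> field_simp
    rw [e, norm_smul, norm_neg, Real.norm_of_nonneg (by positivity)]
    calc _ ≤ (√(n : ℝ))⁻¹ * (m : ℝ)⁻¹ * (ε * size A * √m) := by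
          gcongr; exact norm_vec_error_le hε hm hA
      _ = ε * c := by
          rw [hc]
          generalize √(m : ℝ) = α at hsm hsm2
          rw [← hsm2]
          field_simp
  have h2 : ∀ x, inner ℝ u x = 0 → |inner ℝ w (T x)| ≤ ε * c * ‖x‖ := by
    intro x hx
    obtain ⟨X, rfl⟩ := exists_vec_eq x
    have htr : X.trace = 0 := by
      rw [hu, inner_smul_left, inner_vec_one] at hx
      simpa [hsn.ne'] using hx
    rw [naturalMatrix_vec, hw, inner_smul_left, inner_vec_one, trace_cpMap]
    have e : rightGram A = (n : ℝ)⁻¹ • (size A • 1 - errorF A) := by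
      rw [errorF, sub_sub_cancel, smul_smul, inv_mul_cancel₀ hn'.ne', one_smul]
    have hF : ‖vec (errorF A)‖ ≤ ε * size A * √n := by
      have := norm_vec_error_le hε hn hA.transpose
      rwa [errorE_transpose_operator, size_transpose_operator] at this
    rw [e, map_smul, map_sub, map_smul, inner_smul_left, inner_sub_left, inner_smul_left,
      inner_vec_one, htr]
    simp only [conj_trivial, mul_zero, zero_sub]
    rw [abs_mul, abs_mul, abs_neg, abs_of_nonneg (by positivity), abs_of_nonneg (by positivity)]
    calc _ ≤ (√(m : ℝ))⁻¹ * ((n : ℝ)⁻¹ * (ε * size A * √n * ‖vec X‖)) := by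
          gcongr
          exact (abs_real_inner_le_norm _ _).trans (by gcongr)
      _ = _ := by
          rw [hc]
          generalize √(n : ℝ) = α at hsn hsn2
          rw [← hsn2]
          field_simp
  refine ⟨fun X Y hX hY => ?_, fun X Y => ?_⟩
  · rw [← naturalMatrix_vec]
    exact inner_le_of_singularValues_one_le T hu1 hw1 hc0 hε hlam huw h1 h2 hgap
      (by rw [hu, inner_smul_left, inner_vec_one, hX, mul_zero])
      (by rw [hw, inner_smul_left, inner_vec_one, hY, mul_zero])
  · rw [← naturalMatrix_vec]
    exact inner_le_of_singularValues_one_le' T hu1 hw1 hc0 hε hε1 hlam huw h1 h2 hgap _ _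

lemma norm_le_one_add {p : ℕ} {L : Matrix (Fin p) (Fin p) ℝ} {δ : ℝ} (hL : ‖L - 1‖ ≤ δ) :
    ‖L‖ ≤ 1 + δ := by
  have := norm_add_le (L - 1) 1
  rw [sub_add_cancel] at this
  exact this.trans (by linarith [norm_one_le p])

lemma norm_vec_conj_sub_le {p : ℕ} {L : Matrix (Fin p) (Fin p) ℝ} {δ : ℝ} (hδ : δ ≤ 1)
    (hL : ‖L - 1‖ ≤ δ) (X : Matrix (Fin p) (Fin p) ℝ) :
    ‖vec (L * X * Lᵀ - X)‖ ≤ 3 * δ * ‖vec X‖ := by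
  have hδ0 : 0 ≤ δ := (norm_nonneg _).trans hL
  have e : L * X * Lᵀ - X = (L - 1) * X * Lᵀ + X * (L - 1)ᵀ := by
    simp only [sub_mul, Matrix.transpose_sub, Matrix.transpose_one, mul_sub, one_mul, mul_one]
    abel
  have hL' := norm_le_one_add hL
  rw [e, map_add]
  refine (norm_add_le _ _).trans ?_
  have h1 : ‖vec ((L - 1) * X * Lᵀ)‖ ≤ δ * ‖vec X‖ * (1 + δ) := by
    refine (norm_vec_mul_le' _ _).trans ?_
    rw [norm_transpose]
    gcongr
    exact (norm_vec_mul_le _ _).trans (by gcongr)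
  have h2 : ‖vec (X * (L - 1)ᵀ)‖ ≤ ‖vec X‖ * δ := by
    refine (norm_vec_mul_le' _ _).trans ?_
    rw [norm_transpose]
    gcongr
  nlinarith [mul_nonneg hδ0 (norm_nonneg (vec X))]

/-- The spectral gap is robust under scaling by matrices close to the identity. -/
lemma inner_cpMap_scaled_le {ε lam δ : ℝ} (hm : 0 < m) (hn : 0 < n) (hs : 0 < size A)
    (hε : 0 ≤ ε) (hε1 : ε ≤ 1) (hlam : ε < lam) (hA : IsNearlyDoublyBalanced ε A)
    (hgap : HasSpectralGap lam A) (hδ : δ ≤ 1) {L : Matrix (Fin m) (Fin m) ℝ}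
    {R : Matrix (Fin n) (Fin n) ℝ} (hL : ‖L - 1‖ ≤ δ) (hR : ‖R - 1‖ ≤ δ)
    {X : Matrix (Fin n) (Fin n) ℝ} {Y : Matrix (Fin m) (Fin m) ℝ} (hX : X.trace = 0)
    (hY : Y.trace = 0) :
    inner ℝ (vec Y) (vec (cpMap (fun i => L * A i * R) X)) ≤
      (1 - lam + ε + 60 * δ) * (size A / √((m : ℝ) * n)) * (‖vec X‖ * ‖vec Y‖) := by
  obtain ⟨h1, h2⟩ := inner_cpMap_le hm hn hs hε hε1 hlam hA hgap
  have hδ0 : 0 ≤ δ := (norm_nonneg _).trans hL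
  set c := size A / √((m : ℝ) * n) with hc
  have hc0 : 0 ≤ c := by positivity
  -- The scaling is moved onto the arguments. The conjugates of X and Y need no longer be traceless,
  -- so the differences X' - X and Y' - Y are treated with the gap-free bound `h2`; they contribute
  -- 12δ and 48δ, together 60δ.
  have e : inner ℝ (vec Y) (vec (cpMap (fun i => L * A i * R) X)) =
      inner ℝ (vec (Lᵀ * Y * L)) (vec (cpMap A (R * X * Rᵀ))) := by
    have : cpMap (fun i => L * A i * R) X = L * cpMap A (R * X * Rᵀ) * Lᵀ := by
      simp only [cpMap, Matrix.mul_sum, Matrix.sum_mul, Matrix.transpose_mul, Matrix.mul_assoc]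
    rw [this, inner_vec_eq_trace, inner_vec_eq_trace]
    generalize cpMap A (R * X * Rᵀ) = Z
    rw [Matrix.transpose_mul, Matrix.transpose_mul, Matrix.transpose_transpose,
      show Y * (L * (Zᵀ * Lᵀ)) = (Y * L * Zᵀ) * Lᵀ by simp only [mul_assoc],
      Matrix.trace_mul_comm, show Lᵀ * (Y * L * Zᵀ) = Lᵀ * Y * L * Zᵀ by simp only [mul_assoc]]
  have hX' := norm_vec_conj_sub_le hδ hR X
  have hY' : ‖vec (Lᵀ * Y * L - Y)‖ ≤ 3 * δ * ‖vec Y‖ := by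
    have := norm_vec_conj_sub_le (L := Lᵀ) hδ
      (by rwa [← Matrix.transpose_one, ← Matrix.transpose_sub, norm_transpose]) Y
    rwa [Matrix.transpose_transpose] at this
  set X' := R * X * Rᵀ with hXd
  set Y' := Lᵀ * Y * L with hYd
  have hlin : ∀ U V, cpMap A (U - V) = cpMap A U - cpMap A V := fun U V => by
    simp only [cpMap, Matrix.mul_sub, Matrix.sub_mul, Finset.sum_sub_distrib]
  have nX : ‖vec X'‖ ≤ 4 * ‖vec X‖ := by
    have := norm_add_le (vec (X' - X)) (vec X)
    rw [← map_add, sub_add_cancel] at this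
    nlinarith [norm_nonneg (vec X)]
  have t1 := h1 X Y hX hY
  have t2 := h2 (X' - X) Y
  have t3 := h2 X' (Y' - Y)
  have t2' : 4 * c * (‖vec (X' - X)‖ * ‖vec Y‖) ≤ 12 * δ * c * (‖vec X‖ * ‖vec Y‖) := by
    calc _ ≤ 4 * c * ((3 * δ * ‖vec X‖) * ‖vec Y‖) := by gcongr
      _ = _ := by ring
  have t3' : 4 * c * (‖vec X'‖ * ‖vec (Y' - Y)‖) ≤ 48 * δ * c * (‖vec X‖ * ‖vec Y‖) := by
    calc _ ≤ 4 * c * ((4 * ‖vec X‖) * (3 * δ * ‖vec Y‖)) := by gcongr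
      _ = _ := by ring
  rw [hlin, map_sub, inner_sub_right] at t2
  have e3 := congrArg (fun z => inner ℝ z (vec (cpMap A X'))) (map_sub vec Y' Y)
  simp only [inner_sub_left] at e3
  rw [e3] at t3
  rw [e]
  linarith

end Gap

/-! ### Condition numbers near the identity. -/

section ConditionNumber

variable {d : ℕ} {M : Matrix (Fin d) (Fin d) ℝ} {x : ℝ}

/-- A matrix within `x ≤ 1 / 2` of the identity is well conditioned. -/
lemma isWellConditioned_of_norm_sub_one_le (hd : 0 < d) (hx : x ≤ 1 / 2) (hM : ‖M - 1‖ ≤ x) :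
    IsWellConditioned (4 * x) M := by
  have hx0 : 0 ≤ x := (norm_nonneg _).trans hM
  have hlow : ∀ v : EuclideanSpace ℝ (Fin d), ‖v‖ = 1 → 1 - x ≤ ‖Matrix.toEuclideanLin M v‖ := by
    intro v hv
    have h1 : ‖WithLp.toLp 2 ((M - 1) *ᵥ v.ofLp)‖ ≤ x := by
      refine (norm_mulVec_le _ _).trans ?_
      rw [WithLp.toLp_ofLp, hv, mul_one]
      exact hM
    have h2 : WithLp.toLp 2 ((M - 1) *ᵥ v.ofLp) = Matrix.toEuclideanLin M v - v := by
      rw [sub_mulVec, one_mulVec]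
      rfl
    rw [h2] at h1
    have := norm_sub_norm_le v (Matrix.toEuclideanLin M v)
    rw [norm_sub_rev, hv] at this
    linarith
  have hup : ∀ v : EuclideanSpace ℝ (Fin d), ‖v‖ = 1 → ‖Matrix.toEuclideanLin M v‖ ≤ 1 + x := by
    intro v hv
    have := norm_mulVec_le M v.ofLp
    rw [WithLp.toLp_ofLp, hv, mul_one] at this
    exact this.trans (norm_le_one_add hM)
  have hfin : Module.finrank ℝ (EuclideanSpace ℝ (Fin d)) = d := by simp
  have hσ0 : singularValue M 0 ≤ 1 + x := by
    obtain ⟨v, hv, hv'⟩ := exists_norm_eq_singularValues (Matrix.toEuclideanLin M)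
      (j := 0) (by rw [hfin]; exact hd)
    exact hv'.symm.le.trans (hup v hv)
  have hσ1 : 1 - x ≤ singularValue M (d - 1) := by
    obtain ⟨v, hv, hv'⟩ := exists_norm_eq_singularValues (Matrix.toEuclideanLin M)
      (j := d - 1) (by rw [hfin]; omega)
    exact (hlow v hv).trans hv'.le
  refine ⟨?_, ?_, hM.trans (by linarith)⟩
  · have : ‖(1 - M : Matrix (Fin d) (Fin d) ℝ)‖ < 1 := by
      rw [norm_sub_rev]
      exact hM.trans_lt (by linarith)
    have : CompleteSpace (Matrix (Fin d) (Fin d) ℝ) := FiniteDimensional.complete ℝ _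
    have := isUnit_one_sub_of_norm_lt_one (x := 1 - M) (by assumption)
    rwa [sub_sub_cancel] at this
  · rw [conditionNumber, div_le_iff₀ (by linarith)]
    -- The claim (1 + x) ≤ (1 + 4x)(1 - x) amounts to 2x² ≤ x, which is where x ≤ 1/2 is needed.
    nlinarith

end ConditionNumber

end OperatorScaling
namespace OperatorScaling

open Set Filter Topology Matrix

/-! ### Derivatives of matrix products, Gram matrices and sizes. -/

section Calculus

variable {m n p k : ℕ}

/-- Multiplication of rectangular matrices as a continuous bilinear map. -/
noncomputable def mulCLM (m n p : ℕ) : Matrix (Fin m) (Fin n) ℝ →L[ℝ] Matrix (Fin n) (Fin p) ℝ →L[ℝ]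
    Matrix (Fin m) (Fin p) ℝ :=
  LinearMap.mkContinuous₂
    (LinearMap.mk₂ ℝ (fun X Y => X * Y) Matrix.add_mul (fun c X Y => Matrix.smul_mul c X Y)
      Matrix.mul_add (fun c X Y => Matrix.mul_smul X c Y)) 1 fun X Y => by
    simpa using Matrix.l2_opNorm_mul X Y

/-- Transposition as a continuous linear map. -/
noncomputable def transposeCLM (m n : ℕ) : Matrix (Fin m) (Fin n) ℝ →L[ℝ] Matrix (Fin n) (Fin m) ℝ :=
  LinearMap.toContinuousLinearMap (Matrix.transposeLinearEquiv (Fin m) (Fin n) ℝ ℝ).toLinearMap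

/-- The map `vec` as a continuous linear map. -/
noncomputable def vecCLM (m n : ℕ) : Matrix (Fin m) (Fin n) ℝ →L[ℝ] EuclideanSpace ℝ (Fin m × Fin n) :=
  LinearMap.toContinuousLinearMap vec

lemma hasDerivWithinAt_matrix_mul {f : ℝ → Matrix (Fin m) (Fin n) ℝ}
    {g : ℝ → Matrix (Fin n) (Fin p) ℝ} {f' : Matrix (Fin m) (Fin n) ℝ}
    {g' : Matrix (Fin n) (Fin p) ℝ} {S : Set ℝ} {t : ℝ} (hf : HasDerivWithinAt f f' S t)
    (hg : HasDerivWithinAt g g' S t) :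
    HasDerivWithinAt (fun τ => f τ * g τ) (f' * g t + f t * g') S t := by
  have := (mulCLM m n p).hasDerivWithinAt_of_bilinear hf hg
  rw [add_comm]
  exact this

lemma hasDerivWithinAt_transpose {f : ℝ → Matrix (Fin m) (Fin n) ℝ}
    {f' : Matrix (Fin m) (Fin n) ℝ} {S : Set ℝ} {t : ℝ} (hf : HasDerivWithinAt f f' S t) :
    HasDerivWithinAt (fun τ => (f τ)ᵀ) f'ᵀ S t :=
  (transposeCLM m n).hasFDerivAt.comp_hasDerivWithinAt t hf

lemma hasDerivWithinAt_vec {f : ℝ → Matrix (Fin m) (Fin n) ℝ}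
    {f' : Matrix (Fin m) (Fin n) ℝ} {S : Set ℝ} {t : ℝ} (hf : HasDerivWithinAt f f' S t) :
    HasDerivWithinAt (fun τ => vec (f τ)) (vec f') S t :=
  (vecCLM m n).hasFDerivAt.comp_hasDerivWithinAt t hf

lemma hasDerivWithinAt_norm_vec_sq {f : ℝ → Matrix (Fin m) (Fin n) ℝ}
    {f' : Matrix (Fin m) (Fin n) ℝ} {S : Set ℝ} {t : ℝ} (hf : HasDerivWithinAt f f' S t) :
    HasDerivWithinAt (fun τ => ‖vec (f τ)‖ ^ 2) (2 * inner ℝ (vec (f t)) (vec f')) S t :=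
  (hasDerivWithinAt_vec hf).norm_sq

variable {𝒜 : ℝ → Fin k → Matrix (Fin m) (Fin n) ℝ} {D : Fin k → Matrix (Fin m) (Fin n) ℝ}
  {S : Set ℝ} {t : ℝ}

lemma hasDerivWithinAt_size (h : ∀ i, HasDerivWithinAt (fun τ => 𝒜 τ i) (D i) S t) :
    HasDerivWithinAt (fun τ => size (𝒜 τ)) (2 * ∑ i, inner ℝ (vec (𝒜 t i)) (vec (D i))) S t := by
  simp only [size_eq_sum_norm_vec, Finset.mul_sum]
  exact HasDerivWithinAt.fun_sum fun i _ => hasDerivWithinAt_norm_vec_sq (h i)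

lemma hasDerivWithinAt_leftGram (h : ∀ i, HasDerivWithinAt (fun τ => 𝒜 τ i) (D i) S t) :
    HasDerivWithinAt (fun τ => leftGram (𝒜 τ)) (∑ i, (D i * (𝒜 t i)ᵀ + 𝒜 t i * (D i)ᵀ)) S t :=
  HasDerivWithinAt.fun_sum fun i _ =>
    hasDerivWithinAt_matrix_mul (h i) (hasDerivWithinAt_transpose (h i))

end Calculus

/-! ### The vector field of the flow and algebraic identities for it. -/

section Field

variable {m n k : ℕ} (A : Fin k → Matrix (Fin m) (Fin n) ℝ)

/-- The vector field of the gradient flow. -/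
noncomputable def flowField : Fin k → Matrix (Fin m) (Fin n) ℝ :=
  fun i => errorE A * A i + A i * errorF A

lemma flowField_transpose_operator (i : Fin k) :
    flowField (fun i => (A i)ᵀ) i = (flowField A i)ᵀ := by
  simp only [flowField, errorE_transpose_operator, errorF_transpose_operator,
    Matrix.transpose_add, Matrix.transpose_mul, errorE_transpose, errorF_transpose]
  abel

/-- The potential `‖E‖_F ^ 2 / m + ‖F‖_F ^ 2 / n`. -/
noncomputable def potential : ℝ := ‖vec (errorE A)‖ ^ 2 / m + ‖vec (errorF A)‖ ^ 2 / n

lemma potential_nonneg : 0 ≤ potential A := by unfold potential; positivity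

lemma potential_transpose_operator : potential (fun i => (A i)ᵀ) = potential A := by
  simp only [potential, errorE_transpose_operator, errorF_transpose_operator]
  ring

lemma potential_le (hm : 0 < m) (hn : 0 < n) :
    potential A ≤ ‖errorE A‖ ^ 2 + ‖errorF A‖ ^ 2 := by
  have hm' : (0 : ℝ) < m := by exact_mod_cast hm
  have hn' : (0 : ℝ) < n := by exact_mod_cast hn
  unfold potential
  gcongr
  · rw [div_le_iff₀ hm', mul_comm]; exact norm_vec_sq_le _
  · rw [div_le_iff₀ hn', mul_comm]; exact norm_vec_sq_le _

/-- The factor m lost here, by bounding the operator norm by the Frobenius norm, is the source of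
the logarithm of m in the final bounds. -/
lemma norm_errorE_sq_le (hm : 0 < m) : ‖errorE A‖ ^ 2 ≤ m * potential A := by
  have hm' : (0 : ℝ) < m := by exact_mod_cast hm
  have h1 : ‖errorE A‖ ^ 2 ≤ ‖vec (errorE A)‖ ^ 2 := by gcongr; exact norm_le_norm_vec _
  have h2 : 0 ≤ ‖vec (errorF A)‖ ^ 2 / n := by positivity
  calc _ ≤ _ := h1
    _ = m * (‖vec (errorE A)‖ ^ 2 / m) := by field_simp
    _ ≤ _ := by unfold potential; gcongr; linarith

/-- The sum is the trace of Φ(F), that is, the pairing of F with `rightGram A`; n times the latter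
is sI - F, and F is traceless. -/
lemma sum_inner_mul_errorF (hn : 0 < n) :
    ∑ i, inner ℝ (vec (A i)) (vec (A i * errorF A)) = -(‖vec (errorF A)‖ ^ 2 / n) := by
  have hn' : (n : ℝ) ≠ 0 := by exact_mod_cast hn.ne'
  have h1 : ∑ i, inner ℝ (vec (A i)) (vec (A i * errorF A)) = (cpMap A (errorF A)).trace := by
    simp only [cpMap, Matrix.trace_sum]
    refine Finset.sum_congr rfl fun i _ => ?_
    rw [real_inner_comm, inner_vec_eq_trace]
  have e : (n : ℝ) • rightGram A = size A • 1 - errorF A := by rw [errorF, sub_sub_cancel]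
  have h2 : (n : ℝ) * inner ℝ (vec (rightGram A)) (vec (errorF A)) = -‖vec (errorF A)‖ ^ 2 := by
    have : (n : ℝ) * inner ℝ (vec (rightGram A)) (vec (errorF A)) =
        inner ℝ (vec ((n : ℝ) • rightGram A)) (vec (errorF A)) := by
      rw [map_smul, inner_smul_left]; simp
    rw [this, e, map_sub, map_smul, inner_sub_left, inner_smul_left, inner_vec_one, trace_errorF,
      real_inner_self_eq_norm_sq]
    ring
  rw [h1, trace_cpMap]
  field_simp
  linarith

lemma sum_inner_errorE_mul (hm : 0 < m) :
    ∑ i, inner ℝ (vec (A i)) (vec (errorE A * A i)) = -(‖vec (errorE A)‖ ^ 2 / m) := by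
  have h := sum_inner_mul_errorF (fun i => (A i)ᵀ) hm
  rw [errorF_transpose_operator] at h
  rw [← h]
  refine Finset.sum_congr rfl fun i _ => ?_
  rw [inner_vec_eq_trace, inner_vec_eq_trace, Matrix.transpose_mul, Matrix.transpose_mul,
    Matrix.transpose_transpose, Matrix.trace_mul_comm, errorE_transpose, Matrix.mul_assoc,
    Matrix.trace_mul_comm, Matrix.mul_assoc]

lemma sum_inner_flowField (hm : 0 < m) (hn : 0 < n) :
    ∑ i, inner ℝ (vec (A i)) (vec (flowField A i)) = -potential A := by
  simp only [flowField, map_add, inner_add_right, Finset.sum_add_distrib,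
    sum_inner_mul_errorF A hn, sum_inner_errorE_mul A hm, potential]
  ring

/-- Since m·`leftGram A` = sI - E, the products of E with it become sE - E²; the two terms with F
coincide by symmetry of F. -/
lemma smul_sum_flowField :
    (m : ℝ) • ∑ i, (flowField A i * (A i)ᵀ + A i * (flowField A i)ᵀ) =
      (2 * size A) • errorE A - (2 : ℝ) • (errorE A * errorE A) +
        (2 * (m : ℝ)) • cpMap A (errorF A) := by
  have h1 : ∑ i, (flowField A i * (A i)ᵀ + A i * (flowField A i)ᵀ) =
      errorE A * leftGram A + leftGram A * errorE A + (2 : ℝ) • cpMap A (errorF A) := by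
    rw [two_smul]
    simp only [flowField, leftGram, cpMap, Matrix.mul_sum, Matrix.sum_mul,
      ← Finset.sum_add_distrib]
    refine Finset.sum_congr rfl fun i _ => ?_
    simp only [Matrix.transpose_add, Matrix.transpose_mul, errorE_transpose, errorF_transpose,
      Matrix.add_mul, Matrix.mul_add, Matrix.mul_assoc]
    abel
  rw [h1, smul_add, smul_add, ← Matrix.mul_smul, ← Matrix.smul_mul, smul_leftGram, smul_smul]
  simp only [mul_sub, sub_mul, Matrix.mul_smul, Matrix.smul_mul, mul_one, one_mul]
  module

/-- The remainder in the evolution equation of the left error matrix. -/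
noncomputable def errorERemainder : Matrix (Fin m) (Fin m) ℝ :=
  -(2 * potential A) • 1 + (2 : ℝ) • (errorE A * errorE A) - (2 * (m : ℝ)) • cpMap A (errorF A)

/-- The remainder in the evolution equation of the right error matrix. -/
noncomputable def errorFRemainder : Matrix (Fin n) (Fin n) ℝ := errorERemainder (fun i => (A i)ᵀ)

/-- All terms are quadratic in the errors except 2s‖F‖, which has the same coefficient as the
damping 2s‖E‖. -/
lemma norm_errorERemainder_le : ‖errorERemainder A‖ ≤
    2 * potential A + 2 * ‖errorE A‖ ^ 2 + 2 * (‖errorF A‖ * (size A + ‖errorE A‖)) := by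
  have hp := potential_nonneg A
  unfold errorERemainder
  refine (norm_sub_le _ _).trans (add_le_add ((norm_add_le _ _).trans (add_le_add ?_ ?_)) ?_)
  · rw [norm_smul, norm_neg, Real.norm_of_nonneg (by positivity)]
    exact mul_le_of_le_one_right (by positivity) (norm_one_le m)
  · rw [norm_smul, Real.norm_of_nonneg (by positivity), sq]
    gcongr
    exact norm_mul_le _ _
  · rw [norm_smul, Real.norm_of_nonneg (by positivity), mul_assoc]
    exact mul_le_mul_of_nonneg_left (norm_cpMap_le_size A _) zero_le_two

lemma norm_errorFRemainder_le : ‖errorFRemainder A‖ ≤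
    2 * potential A + 2 * ‖errorF A‖ ^ 2 + 2 * (‖errorE A‖ * (size A + ‖errorF A‖)) := by
  have := norm_errorERemainder_le (fun i => (A i)ᵀ)
  rwa [potential_transpose_operator, errorE_transpose_operator, errorF_transpose_operator,
    size_transpose_operator] at this

/-- The maps of an operator and of its transpose are adjoint, so the cross terms from E and from F
in the derivative of the potential are equal. -/
lemma inner_cpMap_transpose (X : Matrix (Fin m) (Fin m) ℝ) (Y : Matrix (Fin n) (Fin n) ℝ) :
    inner ℝ (vec Y) (vec (cpMap (fun i => (A i)ᵀ) X)) = inner ℝ (vec (cpMap A Y)) (vec X) := by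
  rw [inner_vec_eq_trace, inner_vec_eq_trace, cpMap, cpMap, Matrix.transpose_sum, Matrix.mul_sum,
    Matrix.sum_mul, Matrix.trace_sum, Matrix.trace_sum]
  refine Finset.sum_congr rfl fun i _ => ?_
  simp only [Matrix.transpose_mul, Matrix.transpose_transpose]
  rw [← Matrix.mul_assoc, ← Matrix.mul_assoc, Matrix.trace_mul_comm]
  simp only [Matrix.mul_assoc]

end Field

/-! ### Evolution equations along the flow. -/

section Flow

variable {m n k : ℕ} {𝒜 : ℝ → Fin k → Matrix (Fin m) (Fin n) ℝ} {S : Set ℝ} {t : ℝ}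

lemma hasDerivWithinAt_size_flow (hm : 0 < m) (hn : 0 < n)
    (h : ∀ i, HasDerivWithinAt (fun τ => 𝒜 τ i) (flowField (𝒜 t) i) S t) :
    HasDerivWithinAt (fun τ => size (𝒜 τ)) (-(2 * potential (𝒜 t))) S t := by
  convert hasDerivWithinAt_size h using 1
  rw [sum_inner_flowField _ hm hn]
  ring

lemma hasDerivWithinAt_errorE (hm : 0 < m) (hn : 0 < n)
    (h : ∀ i, HasDerivWithinAt (fun τ => 𝒜 τ i) (flowField (𝒜 t) i) S t) :
    HasDerivWithinAt (fun τ => errorE (𝒜 τ))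
      (-(2 * size (𝒜 t)) • errorE (𝒜 t) + errorERemainder (𝒜 t)) S t := by
  have := ((hasDerivWithinAt_size_flow hm hn h).smul_const (1 : Matrix (Fin m) (Fin m) ℝ)).sub
    ((hasDerivWithinAt_leftGram h).const_smul (m : ℝ))
  rw [smul_sum_flowField] at this
  refine this.congr_deriv ?_
  rw [errorERemainder]
  module

lemma hasDerivWithinAt_errorF (hm : 0 < m) (hn : 0 < n)
    (h : ∀ i, HasDerivWithinAt (fun τ => 𝒜 τ i) (flowField (𝒜 t) i) S t) :
    HasDerivWithinAt (fun τ => errorF (𝒜 τ))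
      (-(2 * size (𝒜 t)) • errorF (𝒜 t) + errorFRemainder (𝒜 t)) S t := by
  have := hasDerivWithinAt_errorE (𝒜 := fun τ i => (𝒜 τ i)ᵀ) (t := t) (S := S) hn hm
    (fun i => by
      rw [flowField_transpose_operator]
      exact hasDerivWithinAt_transpose (h i))
  simpa only [errorE_transpose_operator, size_transpose_operator, errorFRemainder] using this

/-- The multiple of the identity in each remainder drops out because the error matrices are
traceless. The weights 1/m and 1/n cancel the factors m and n of the two cross terms, which then
merge. -/
lemma hasDerivWithinAt_potential (hm : 0 < m) (hn : 0 < n)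
    (h : ∀ i, HasDerivWithinAt (fun τ => 𝒜 τ i) (flowField (𝒜 t) i) S t) :
    HasDerivWithinAt (fun τ => potential (𝒜 τ))
      (-(4 * size (𝒜 t) * potential (𝒜 t)) +
        4 * (inner ℝ (vec (errorE (𝒜 t))) (vec (errorE (𝒜 t) * errorE (𝒜 t))) / m +
          inner ℝ (vec (errorF (𝒜 t))) (vec (errorF (𝒜 t) * errorF (𝒜 t))) / n) -
        8 * inner ℝ (vec (errorE (𝒜 t))) (vec (cpMap (𝒜 t) (errorF (𝒜 t))))) S t := by
  have hm' : (m : ℝ) ≠ 0 := by exact_mod_cast hm.ne'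
  have hn' : (n : ℝ) ≠ 0 := by exact_mod_cast hn.ne'
  have h1 := ((hasDerivWithinAt_norm_vec_sq (hasDerivWithinAt_errorE hm hn h)).div_const
    (m : ℝ)).add ((hasDerivWithinAt_norm_vec_sq (hasDerivWithinAt_errorF hm hn h)).div_const (n : ℝ))
  refine h1.congr_deriv ?_
  have i1 : ∀ {p : ℕ} (X : Matrix (Fin p) (Fin p) ℝ), inner ℝ (vec X) (vec 1) = X.trace :=
    fun X => by rw [real_inner_comm, inner_vec_one]
  simp only [errorFRemainder, errorERemainder, map_add, map_sub, map_smul, inner_add_right,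
    inner_sub_right, inner_smul_right, i1, trace_errorE, trace_errorF,
    errorE_transpose_operator, errorF_transpose_operator, inner_cpMap_transpose,
    real_inner_self_eq_norm_sq]
  rw [real_inner_comm (vec (errorE (𝒜 t))) (vec (cpMap (𝒜 t) (errorF (𝒜 t)))), potential]
  field_simp
  ring

end Flow

end OperatorScaling
namespace OperatorScaling

open Set Filter Topology Matrix
open scoped NNReal

/-! ### Global existence of the gradient flow. -/

section Existence

variable {m n k : ℕ}

lemma contDiff_matrix_mul {V : Type*} [NormedAddCommGroup V] [NormedSpace ℝ V] {p q r : ℕ}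
    {f : V → Matrix (Fin p) (Fin q) ℝ} {g : V → Matrix (Fin q) (Fin r) ℝ} (hf : ContDiff ℝ 1 f)
    (hg : ContDiff ℝ 1 g) : ContDiff ℝ 1 fun x => f x * g x := by
  have h : IsBoundedBilinearMap ℝ
      fun z : Matrix (Fin p) (Fin q) ℝ × Matrix (Fin q) (Fin r) ℝ => z.1 * z.2 :=
    { add_left := Matrix.add_mul
      smul_left := fun c X Y => Matrix.smul_mul c X Y
      add_right := Matrix.mul_add
      smul_right := fun c X Y => Matrix.mul_smul X c Y
      bound := ⟨1, one_pos, fun X Y => by simpa using Matrix.l2_opNorm_mul X Y⟩ }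
  exact h.contDiff.comp (hf.prodMk hg)

lemma contDiff_size :
    ContDiff ℝ 1 (fun A : Fin k → Matrix (Fin m) (Fin n) ℝ => size A) := by
  simp only [size_eq_sum_norm_vec]
  exact ContDiff.sum fun i _ => ((vecCLM m n).contDiff.comp (contDiff_apply ℝ _ i)).norm_sq ℝ

lemma contDiff_transpose_operator : ContDiff ℝ 1
    (fun (A : Fin k → Matrix (Fin m) (Fin n) ℝ) (i : Fin k) => (A i)ᵀ) :=
  contDiff_pi.2 fun i => (transposeCLM m n).contDiff.comp (contDiff_apply ℝ _ i)

lemma contDiff_errorE :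
    ContDiff ℝ 1 (fun A : Fin k → Matrix (Fin m) (Fin n) ℝ => errorE A) := by
  unfold errorE leftGram
  refine (contDiff_size.smul contDiff_const).sub (ContDiff.const_smul (m : ℝ) ?_)
  exact ContDiff.sum fun i _ => contDiff_matrix_mul (contDiff_apply ℝ _ i)
    ((transposeCLM m n).contDiff.comp (contDiff_apply ℝ _ i))

lemma contDiff_errorF :
    ContDiff ℝ 1 (fun A : Fin k → Matrix (Fin m) (Fin n) ℝ => errorF A) := by
  simp only [← errorE_transpose_operator]
  exact contDiff_errorE.comp contDiff_transpose_operator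

lemma contDiff_flowField :
    ContDiff ℝ 1 (flowField : (Fin k → Matrix (Fin m) (Fin n) ℝ) → _) :=
  contDiff_pi.2 fun i => (contDiff_matrix_mul contDiff_errorE (contDiff_apply ℝ _ i)).add
    (contDiff_matrix_mul (contDiff_apply ℝ _ i) contDiff_errorF)

lemma norm_le_sqrt_size (A : Fin k → Matrix (Fin m) (Fin n) ℝ) : ‖A‖ ≤ √(size A) := by
  refine (pi_norm_le_iff_of_nonneg (Real.sqrt_nonneg _)).2 fun i => ?_
  refine (norm_le_norm_vec _).trans (Real.le_sqrt_of_sq_le ?_)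
  rw [size_eq_sum_norm_vec]
  exact Finset.single_le_sum (f := fun i => ‖vec (A i)‖ ^ 2) (fun i _ => by positivity)
    (Finset.mem_univ i)

/-- The gradient flow exists for all times. -/
lemma exists_isGradientFlow (hm : 0 < m) (hn : 0 < n) (A : Fin k → Matrix (Fin m) (Fin n) ℝ) :
    ∃ 𝒜 : ℝ → Fin k → Matrix (Fin m) (Fin n) ℝ, IsGradientFlow A 𝒜 := by
  have : CompleteSpace (Fin k → Matrix (Fin m) (Fin n) ℝ) := FiniteDimensional.complete ℝ _
  have hρ : 0 < √(size A) + 1 := by positivity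
  let χ : ContDiffBump (0 : Fin k → Matrix (Fin m) (Fin n) ℝ) :=
    ⟨√(size A) + 1, √(size A) + 2, hρ, by linarith⟩
  let h : (Fin k → Matrix (Fin m) (Fin n) ℝ) → Fin k → Matrix (Fin m) (Fin n) ℝ :=
    fun x => χ x • flowField x
  have hcont : ContDiff ℝ 1 h := χ.contDiff.smul contDiff_flowField
  have hcomp : HasCompactSupport h := χ.hasCompactSupport.smul_right
  obtain ⟨K, hK⟩ := hcont.lipschitzWith_of_hasCompactSupport hcomp one_ne_zero
  obtain ⟨B, hB⟩ := hcomp.exists_bound_of_continuous hcont.continuous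
  obtain ⟨f, hf0, hf⟩ := exists_solution_Ici (v := fun _ => h) (x₀ := A)
    (fun T => ⟨K, fun _ _ => hK⟩)
    (fun T hT => exists_solution_Icc (K := K) (M := B.toNNReal) hT (fun _ _ => hK)
      (fun x => continuousOn_const) (fun _ _ x => (hB x).trans (Real.le_coe_toNNReal B)) A)
  have hsize : ∀ t, 0 ≤ t → HasDerivWithinAt (fun τ => size (f τ))
      (-(2 * (χ (f t) * potential (f t)))) (Ici 0) t := by
    intro t ht
    have := hasDerivWithinAt_size (fun i => (hasDerivWithinAt_pi.1 (hf t ht)) i)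
    refine this.congr_deriv ?_
    simp only [h, Pi.smul_apply, map_smul, inner_smul_right]
    rw [← Finset.mul_sum, sum_inner_flowField _ hm hn]
    ring
  -- The cutoff is nonnegative, so the size decreases along the truncated flow too. The trajectory
  -- thus stays in the ball where the cutoff is 1.
  have hle : ∀ t, 0 ≤ t → size (f t) ≤ size A := by
    intro t ht
    have := image_le_of_deriv_right_le_deriv_boundary (f := fun τ => size (f τ))
      (B := fun _ => size A) (B' := fun _ => 0) (a := 0) (b := t)
      (fun s hs => ((hsize s hs.1).continuousWithinAt).mono Icc_subset_Ici_self)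
      (fun s hs => (hsize s hs.1).mono (Ici_subset_Ici.2 hs.1))
      (by rw [hf0]) continuousOn_const (fun s _ => hasDerivWithinAt_const _ _ _)
      (fun s _ => by
        have := mul_nonneg (χ.nonneg (x := f s)) (potential_nonneg (f s))
        linarith)
    exact this ⟨ht, le_rfl⟩
  refine ⟨f, hf0, fun t ht i => ?_⟩
  have h1 : χ (f t) = 1 := by
    refine χ.one_of_mem_closedBall ?_
    rw [mem_closedBall_zero_iff]
    calc ‖f t‖ ≤ √(size (f t)) := norm_le_sqrt_size _
      _ ≤ √(size A) := Real.sqrt_le_sqrt (hle t ht)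
      _ ≤ √(size A) + 1 := by linarith
  have h2 := hasDerivWithinAt_pi.1 (hf t ht) i
  simp only [h, h1, one_smul] at h2
  exact h2

end Existence

/-! ### The flow as a two-sided scaling of its initial value. -/

section Scaling

variable {m n k : ℕ} {A : Fin k → Matrix (Fin m) (Fin n) ℝ}
  {𝒜 : ℝ → Fin k → Matrix (Fin m) (Fin n) ℝ}

lemma IsGradientFlow.hasDerivWithinAt (h : IsGradientFlow A 𝒜) {t : ℝ} (ht : 0 ≤ t) (i : Fin k) :
    HasDerivWithinAt (fun τ => 𝒜 τ i) (flowField (𝒜 t) i) (Ici 0) t :=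
  h.2 t ht i

lemma IsGradientFlow.continuousOn (h : IsGradientFlow A 𝒜) : ContinuousOn 𝒜 (Ici 0) :=
  fun _ ht => (hasDerivWithinAt_pi.2 fun i => h.hasDerivWithinAt ht i).continuousWithinAt

lemma IsGradientFlow.continuousOn_errorE (h : IsGradientFlow A 𝒜) :
    ContinuousOn (fun t => errorE (𝒜 t)) (Ici 0) :=
  contDiff_errorE.continuous.comp_continuousOn h.continuousOn

lemma IsGradientFlow.continuousOn_errorF (h : IsGradientFlow A 𝒜) :
    ContinuousOn (fun t => errorF (𝒜 t)) (Ici 0) :=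
  contDiff_errorF.continuous.comp_continuousOn h.continuousOn

/-- The solutions `L`, `R` of `L' = E L`, `R' = R F` describe the gradient flow as a scaling. -/
lemma IsGradientFlow.eq_scaling (h : IsGradientFlow A 𝒜) {L : ℝ → Matrix (Fin m) (Fin m) ℝ}
    {R : ℝ → Matrix (Fin n) (Fin n) ℝ} (hL0 : L 0 = 1) (hR0 : R 0 = 1)
    (hL : ∀ t, 0 ≤ t → HasDerivWithinAt L (errorE (𝒜 t) * L t) (Ici 0) t)
    (hR : ∀ t, 0 ≤ t → HasDerivWithinAt R (R t * errorF (𝒜 t)) (Ici 0) t) {t : ℝ} (ht : 0 ≤ t)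
    (i : Fin k) : 𝒜 t i = L t * A i * R t := by
  obtain ⟨M, hM⟩ := isCompact_Icc.exists_bound_of_continuousOn
    (h.continuousOn_errorE.mono (Icc_subset_Ici_self : Icc 0 t ⊆ Ici 0))
  obtain ⟨N, hN⟩ := isCompact_Icc.exists_bound_of_continuousOn
    (h.continuousOn_errorF.mono (Icc_subset_Ici_self : Icc 0 t ⊆ Ici 0))
  -- With the trajectory frozen in the coefficients, both sides solve the linear equation X' = E X +
  -- X F with the same initial value.
  refine eqOn_Icc_of_lipschitzWith (v := fun s X => errorE (𝒜 s) * X + X * errorF (𝒜 s))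
    (f := fun s => 𝒜 s i) (g := fun s => L s * A i * R s) (T := t) (K := (M + N).toNNReal)
    (fun s hs => LipschitzWith.of_dist_le_mul fun X Y => ?_)
    (fun s hs => (h.2 s hs.1 i).mono Icc_subset_Ici_self)
    (fun s hs => ?_) (by simp [h.1, hL0, hR0]) ⟨ht, le_rfl⟩
  · rw [dist_eq_norm, dist_eq_norm]
    have e : errorE (𝒜 s) * X + X * errorF (𝒜 s) - (errorE (𝒜 s) * Y + Y * errorF (𝒜 s)) =
        errorE (𝒜 s) * (X - Y) + (X - Y) * errorF (𝒜 s) := by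
      rw [Matrix.mul_sub, Matrix.sub_mul]; abel
    rw [e]
    refine ((norm_add_le _ _).trans (add_le_add (Matrix.l2_opNorm_mul _ _)
      (Matrix.l2_opNorm_mul _ _))).trans ?_
    have h1 := Real.le_coe_toNNReal (M + N)
    have h2 : ‖errorE (𝒜 s)‖ ≤ M := hM s hs
    have h3 : ‖errorF (𝒜 s)‖ ≤ N := hN s hs
    calc ‖errorE (𝒜 s)‖ * ‖X - Y‖ + ‖X - Y‖ * ‖errorF (𝒜 s)‖
        ≤ M * ‖X - Y‖ + ‖X - Y‖ * N := by gcongr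
      _ = (M + N) * ‖X - Y‖ := by ring
      _ ≤ _ := by gcongr
  · have h1 := hasDerivWithinAt_matrix_mul (hasDerivWithinAt_matrix_mul (hL s hs.1)
      (hasDerivWithinAt_const s (Ici 0) (A i))) (hR s hs.1)
    refine (h1.congr_deriv ?_).mono Icc_subset_Ici_self
    simp only [Matrix.mul_assoc, Matrix.mul_zero, add_zero]

end Scaling

end OperatorScaling
namespace OperatorScaling

open Set Filter Topology Matrix

/-! ### Differential inequalities for norms and a continuity argument. -/

section Fencing

variable {V : Type*} [NormedAddCommGroup V] [NormedSpace ℝ V]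

/-- The upper right derivative of the norm of a solution of `g' = -σ g + w` is at most
`-σ ‖g‖ + ‖w‖`. -/
lemma frequently_slope_norm_lt {g : ℝ → V} {w : V} {σ x r : ℝ}
    (hg : HasDerivWithinAt g (-σ • g x + w) (Ici x) x) (hr : -σ * ‖g x‖ + ‖w‖ < r) :
    ∃ᶠ z in 𝓝[>] x, slope (fun τ => ‖g τ‖) x z < r := by
  apply Eventually.frequently
  set η := (r - (-σ * ‖g x‖ + ‖w‖)) / 2 with hη
  have hη0 : 0 < η := by rw [hη]; linarith
  have h1 := (hg.isLittleO.def hη0).filter_mono (nhdsWithin_mono x Ioi_subset_Ici_self)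
  -- Close to x the factor 1 - σ(z - x) is nonnegative, so its absolute value keeps the damping.
  have h2 : ∀ᶠ z in 𝓝[>] x, σ * (z - x) ≤ 1 := by
    have : Tendsto (fun z => σ * (z - x)) (𝓝[>] x) (𝓝 (σ * (x - x))) :=
      (Continuous.tendsto (by fun_prop) x).mono_left nhdsWithin_le_nhds
    rw [sub_self, mul_zero] at this
    exact (this.eventually_lt_const one_pos).mono fun z hz => hz.le
  filter_upwards [h1, h2, self_mem_nhdsWithin] with z hz1 hz2 hz3
  have hzx : 0 < z - x := sub_pos.2 hz3
  rw [Real.norm_of_nonneg hzx.le] at hz1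
  rw [slope_def_field, div_lt_iff₀ hzx]
  have h3 : g z = (g z - g x - (z - x) • (-σ • g x + w)) +
      ((1 - σ * (z - x)) • g x + (z - x) • w) := by module
  have h4 : ‖g z‖ ≤ η * (z - x) + ((1 - σ * (z - x)) * ‖g x‖ + (z - x) * ‖w‖) := by
    rw [h3]
    refine (norm_add_le _ _).trans (add_le_add hz1 ((norm_add_le _ _).trans (add_le_add ?_ ?_)))
    · rw [norm_smul, Real.norm_of_nonneg (by linarith)]
    · rw [norm_smul, Real.norm_of_nonneg hzx.le]
  nlinarith

/-- Fencing for solutions of `g' = -σ g + w`. -/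
lemma norm_le_of_fence {g w : ℝ → V} {σ B B' : ℝ → ℝ} {T : ℝ}
    (hg : ∀ t, 0 ≤ t → HasDerivWithinAt g (-σ t • g t + w t) (Ici 0) t)
    (hB : ∀ t, HasDerivAt B (B' t) t) (h0 : ‖g 0‖ ≤ B 0)
    (hfence : ∀ t ∈ Ico 0 T, ‖g t‖ = B t → -σ t * ‖g t‖ + ‖w t‖ < B' t) :
    ∀ t ∈ Icc 0 T, ‖g t‖ ≤ B t :=
  image_le_of_liminf_slope_right_lt_deriv_boundary
    (f' := fun t => -σ t * ‖g t‖ + ‖w t‖)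
    (fun t ht => ((hg t ht.1).continuousWithinAt.mono Icc_subset_Ici_self).norm)
    (fun t ht _ hr => frequently_slope_norm_lt
      ((hg t ht.1).mono (Ici_subset_Ici.2 ht.1)) hr) h0 hB hfence

/-- A continuity argument: a bound that improves itself holds for all times. -/
lemma le_of_self_improving {f : ℝ → ℝ} {η : ℝ} (hη : 0 < η) (hf : ContinuousOn f (Ici 0))
    (h0 : f 0 < η)
    (h : ∀ t, 0 ≤ t → (∀ τ ∈ Icc 0 t, f τ ≤ η) → f t ≤ η / 2) : ∀ t, 0 ≤ t → f t ≤ η := by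
  by_contra! hcon
  obtain ⟨t₁, ht₁, hft₁⟩ := hcon
  have hcomp : IsCompact (Icc 0 t₁ ∩ f ⁻¹' Ici η) :=
    isCompact_Icc.of_isClosed_subset
      ((hf.mono Icc_subset_Ici_self).preimage_isClosed_of_isClosed isClosed_Icc isClosed_Ici)
      inter_subset_left
  obtain ⟨τ, ⟨hτ, hfτ⟩, hmin⟩ := hcomp.exists_isLeast ⟨t₁, ⟨ht₁, le_rfl⟩, hft₁.le⟩
  have hlt : ∀ s, 0 ≤ s → s < τ → f s < η := by
    intro s hs hsτ
    by_contra! hc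
    exact absurd (hmin ⟨⟨hs, hsτ.le.trans hτ.2⟩, hc⟩) (not_le.2 hsτ)
  have hτ0 : 0 < τ := by
    rcases hτ.1.eq_or_lt with h' | h'
    · rw [← h'] at hfτ
      exact absurd hfτ (not_le.2 h0)
    · exact h'
  have hhalf : ∀ s ∈ Ico 0 τ, f s ≤ η / 2 := fun s hs =>
    h s hs.1 fun r hr => (hlt r hr.1 (hr.2.trans_lt hs.2)).le
  have hcont : ContinuousWithinAt f (Ico 0 τ) τ := (hf τ hτ.1).mono (fun s hs => hs.1)
  -- At the first time τ with f ≥ η, continuity from the left forces f(τ) ≤ η/2.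
  have hcl : τ ∈ closure (Ico 0 τ) := by
    rw [closure_Ico hτ0.ne]; exact ⟨hτ.1, le_rfl⟩
  have := hcont.closure_le hcl continuousWithinAt_const hhalf
  have h3 : η ≤ f τ := hfτ
  linarith

end Fencing

/-! ### A smooth substitute for min(1, b·exp(-at)), usable as a fence, and its integral. -/

section Logistic

/-- The profile `y / (1 + y)` with `y = b exp (-a t)`. -/
noncomputable def profile (a b t : ℝ) : ℝ :=
  b * Real.exp (-a * t) / (1 + b * Real.exp (-a * t))

/-- A primitive of `profile`. -/
noncomputable def profileIntegral (a b t : ℝ) : ℝ :=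
  (Real.log (1 + b) - Real.log (1 + b * Real.exp (-a * t))) / a

variable {a b : ℝ}

lemma profile_pos (hb : 0 < b) (t : ℝ) : 0 < profile a b t := by
  unfold profile; positivity

lemma profile_le_one (hb : 0 < b) (t : ℝ) : profile a b t ≤ 1 := by
  unfold profile
  have : 0 < b * Real.exp (-a * t) := by positivity
  rw [div_le_one (by positivity)]
  linarith

lemma hasDerivAt_exp_neg_mul (a b t : ℝ) :
    HasDerivAt (fun t => b * Real.exp (-a * t)) (b * (Real.exp (-a * t) * -a)) t := by
  have := (((hasDerivAt_id t).const_mul (-a)).exp).const_mul b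
  simpa using this

/-- In this form the relative rate of decay is visibly at most a, as needed for a fence that must
not fall faster than the damping. -/
lemma hasDerivAt_profile (hb : 0 < b) (t : ℝ) :
    HasDerivAt (profile a b) (-a * profile a b t / (1 + b * Real.exp (-a * t))) t := by
  have h := hasDerivAt_exp_neg_mul a b t
  have hpos : (1 + b * Real.exp (-a * t)) ≠ 0 := by positivity
  refine (h.div (h.const_add 1) hpos).congr_deriv ?_
  unfold profile
  field_simp
  ring

lemma hasDerivAt_profileIntegral (ha : 0 < a) (hb : 0 < b) (t : ℝ) :
    HasDerivAt (profileIntegral a b) (profile a b t) t := by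
  have h := (hasDerivAt_exp_neg_mul a b t).const_add 1
  have hpos : (1 + b * Real.exp (-a * t)) ≠ 0 := by positivity
  refine (((h.log hpos).const_sub (Real.log (1 + b))).div_const a).congr_deriv ?_
  unfold profile
  field_simp

lemma profileIntegral_zero : profileIntegral a b 0 = 0 := by simp [profileIntegral]

lemma profileIntegral_le (ha : 0 < a) (hb : 0 < b) (t : ℝ) :
    profileIntegral a b t ≤ Real.log (1 + b) / a := by
  unfold profileIntegral
  gcongr
  have : 0 ≤ Real.log (1 + b * Real.exp (-a * t)) :=
    Real.log_nonneg (by linarith [show 0 < b * Real.exp (-a * t) by positivity])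
  linarith

lemma tendsto_exp_neg_mul (ha : 0 < a) (b : ℝ) :
    Tendsto (fun t => b * Real.exp (-a * t)) atTop (𝓝 0) := by
  have h1 : Tendsto (fun t => -a * t) atTop atBot := by
    exact tendsto_id.const_mul_atTop_of_neg (neg_neg_of_pos ha)
  simpa using (Real.tendsto_exp_atBot.comp h1).const_mul b

lemma tendsto_profile (ha : 0 < a) (b : ℝ) : Tendsto (profile a b) atTop (𝓝 0) := by
  have h := tendsto_exp_neg_mul ha b
  have := h.div (h.const_add 1) (by norm_num)
  rw [zero_div] at this
  exact this

lemma tendsto_profileIntegral (ha : 0 < a) (b : ℝ) :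
    Tendsto (profileIntegral a b) atTop (𝓝 (Real.log (1 + b) / a)) := by
  have h := ((tendsto_exp_neg_mul ha b).const_add 1).log (by norm_num)
  have := (h.const_sub (Real.log (1 + b))).div_const a
  rw [add_zero, Real.log_one, sub_zero] at this
  exact this

/-- The minimum of `1` and `y` is at most `2 y / (1 + y)`. -/
lemma le_profile {c x t : ℝ} (hb : 0 < b) (hc : 0 ≤ c) (h1 : 1 ≤ b * Real.exp (-a * t) → x ≤ c)
    (h2 : x ≤ c * (b * Real.exp (-a * t))) : x ≤ 2 * c * profile a b t := by
  unfold profile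
  have hy : 0 < b * Real.exp (-a * t) := by positivity
  set y := b * Real.exp (-a * t)
  rw [mul_div_assoc', le_div_iff₀ (by positivity)]
  rcases le_or_gt 1 y with h | h
  · nlinarith [h1 h]
  · nlinarith [mul_nonneg hc hy.le]

/-- A function whose derivative is dominated by a convergent profile converges. -/
lemma exists_tendsto_of_norm_deriv_le {V : Type*} [NormedAddCommGroup V] [NormedSpace ℝ V]
    [CompleteSpace V] {f f' : ℝ → V} {c : ℝ} (ha : 0 < a) (hb : 0 < b)
    (hf : ∀ t, 0 ≤ t → HasDerivWithinAt f (f' t) (Ici 0) t)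
    (hf' : ∀ t, 0 ≤ t → ‖f' t‖ ≤ c * profile a b t) : ∃ l, Tendsto f atTop (𝓝 l) := by
  have key : ∀ s t, 0 ≤ s → s ≤ t →
      ‖f t - f s‖ ≤ c * (profileIntegral a b t - profileIntegral a b s) := by
    intro s t hs hst
    refine image_norm_le_of_norm_deriv_right_le_deriv_boundary (f := fun τ => f τ - f s)
      (f' := f') (B := fun τ => c * (profileIntegral a b τ - profileIntegral a b s))
      (B' := fun τ => c * profile a b τ) (a := s) (b := t)
      (fun τ hτ => (((hf τ (hs.trans hτ.1)).continuousWithinAt).mono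
        (fun r hr => hs.trans hr.1)).sub continuousWithinAt_const)
      (fun τ hτ => ((hf τ (hs.trans hτ.1)).mono (Ici_subset_Ici.2 (hs.trans hτ.1))).sub_const _)
      (by simp) (fun τ => ((hasDerivAt_profileIntegral ha hb τ).sub_const _).const_mul c)
      (fun τ hτ => hf' τ (hs.trans hτ.1)) ⟨hst, le_rfl⟩
  -- Increments of f are dominated by those of a convergent function, so the Cauchy property
  -- transfers.
  have hlim := (tendsto_profileIntegral ha b).const_mul c
  have hcau := hlim.cauchy_map
  apply cauchy_map_iff_exists_tendsto.1
  rw [Metric.cauchy_iff] at hcau ⊢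
  refine ⟨inferInstance, fun η hη => ?_⟩
  obtain ⟨t, ht, hd⟩ := hcau.2 η hη
  obtain ⟨N, hN⟩ := mem_atTop_sets.1 (mem_map.1 ht)
  refine ⟨f '' Ici (max N 0), image_mem_map (Ici_mem_atTop _), ?_⟩
  have aux : ∀ s r, max N 0 ≤ s → s ≤ r → dist (f r) (f s) < η := by
    intro s r hs hsr
    rw [dist_eq_norm]
    refine (key s r ((le_max_right _ _).trans hs) hsr).trans_lt ?_
    have := hd _ (hN r ((le_max_left _ _).trans (hs.trans hsr))) _
      (hN s ((le_max_left _ _).trans hs))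
    rw [Real.dist_eq] at this
    refine (le_of_eq ?_).trans_lt ((le_abs_self _).trans_lt this)
    ring
  rintro _ ⟨r, hr, rfl⟩ _ ⟨s, hs, rfl⟩
  rcases le_total r s with h | h
  · rw [dist_comm]; exact aux r s hr h
  · exact aux s r hs h

end Logistic

end OperatorScaling
namespace OperatorScaling

open Set Filter Topology Matrix

/-! ### Decay of the errors and the bootstrap. -/

section Estimates

variable {m n k : ℕ} {A : Fin k → Matrix (Fin m) (Fin n) ℝ}
  {𝒜 : ℝ → Fin k → Matrix (Fin m) (Fin n) ℝ}

/-- Up to times of order `1 / (ε s(A))` the errors at most double. -/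
lemma IsGradientFlow.norm_error_le_of_le (h : IsGradientFlow A 𝒜) (hm : 0 < m) (hn : 0 < n)
    {ε T : ℝ} (hε : 0 < ε) (hs : 0 < size A) (hT : 0 < T) (hεT : 32 * ε * size A * T < 1)
    (hE : ‖errorE A‖ ≤ ε * size A) (hF : ‖errorF A‖ ≤ ε * size A) :
    ∀ t ∈ Icc 0 T, ‖errorE (𝒜 t)‖ ≤ 2 * ε * size A ∧ ‖errorF (𝒜 t)‖ ≤ 2 * ε * size A := by
  have hB : ∀ t, HasDerivAt (fun t => ε * size A * (1 + t / T)) (ε * size A * (1 / T)) t :=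
    fun t => (((hasDerivAt_id t).div_const T).const_add 1).const_mul _
  -- The pair carries the maximum norm. When it equals B, the linear driving term 2sB is cancelled
  -- by the damping, leaving growth at most 8B²; this is less than the slope of the linear fence
  -- since B ≤ 2εs(A) and 32εs(A)T < 1.
  have key := norm_le_of_fence (g := fun t => (errorE (𝒜 t), errorF (𝒜 t)))
    (w := fun t => (errorERemainder (𝒜 t), errorFRemainder (𝒜 t)))
    (σ := fun t => 2 * size (𝒜 t)) (T := T)
    (fun t ht => (hasDerivWithinAt_errorE hm hn fun i => h.hasDerivWithinAt ht i).prodMk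
      (hasDerivWithinAt_errorF hm hn fun i => h.hasDerivWithinAt ht i)) hB
    (by
      rw [h.1, zero_div, add_zero, mul_one]
      exact max_le hE hF)
    (fun t ht hy => by
      set B := ε * size A * (1 + t / T) with hBdef
      have hB2 : B ≤ 2 * ε * size A := by
        have : t / T ≤ 1 := (div_le_one hT).2 ht.2.le
        rw [hBdef]
        nlinarith [mul_pos hε hs]
      have hB0 : 0 ≤ B := by rw [← hy]; exact norm_nonneg _
      have e1 : ‖errorE (𝒜 t)‖ ≤ B := by rw [← hy]; exact le_max_left _ _
      have e2 : ‖errorF (𝒜 t)‖ ≤ B := by rw [← hy]; exact le_max_right _ _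
      have hp : potential (𝒜 t) ≤ 2 * B ^ 2 := by
        refine (potential_le (𝒜 t) hm hn).trans ?_
        have : ‖errorE (𝒜 t)‖ ^ 2 ≤ B ^ 2 := by gcongr
        have : ‖errorF (𝒜 t)‖ ^ 2 ≤ B ^ 2 := by gcongr
        linarith
      have hs0 := size_nonneg (𝒜 t)
      have hw : ‖(errorERemainder (𝒜 t), errorFRemainder (𝒜 t))‖ ≤
          2 * (2 * B ^ 2) + 2 * B ^ 2 + 2 * (B * (size (𝒜 t) + B)) := by
        refine max_le ((norm_errorERemainder_le _).trans ?_)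
          ((norm_errorFRemainder_le _).trans ?_) <;> gcongr
      have hfin : 8 * B ^ 2 < ε * size A * (1 / T) := by
        have : B ^ 2 ≤ (2 * ε * size A) ^ 2 := by gcongr
        rw [mul_one_div, lt_div_iff₀ hT]
        nlinarith [mul_lt_mul_of_pos_left hεT (mul_pos hε hs),
          mul_le_mul_of_nonneg_right this hT.le]
      rw [hy]
      nlinarith)
  intro t ht
  have hB2 : ε * size A * (1 + t / T) ≤ 2 * ε * size A := by
    have : t / T ≤ 1 := (div_le_one hT).2 ht.2
    nlinarith [mul_pos hε hs]
  exact ⟨(le_max_left _ _).trans ((key t ht).trans hB2),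
    (le_max_right _ _).trans ((key t ht).trans hB2)⟩

/-- The scaling `B` of `A` by `L` and `R` is close to `A`, compared with the gap `lam`. -/
structure IsControlled (lam : ℝ) (A B : Fin k → Matrix (Fin m) (Fin n) ℝ)
    (L : Matrix (Fin m) (Fin m) ℝ) (R : Matrix (Fin n) (Fin n) ℝ) : Prop where
  norm_left : ‖L - 1‖ ≤ lam / 1000
  norm_right : ‖R - 1‖ ≤ lam / 1000
  norm_errorE : ‖errorE B‖ ≤ lam / 1000 * size A
  norm_errorF : ‖errorF B‖ ≤ lam / 1000 * size A
  le_size : (1 - lam / 1000) * size A ≤ size B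

lemma inner_vec_mul_self_le {p : ℕ} (X : Matrix (Fin p) (Fin p) ℝ) :
    inner ℝ (vec X) (vec (X * X)) ≤ ‖X‖ * ‖vec X‖ ^ 2 := by
  refine (real_inner_le_norm _ _).trans ?_
  nlinarith [norm_vec_mul_le X X, norm_nonneg (vec X)]

/-- The potential decays at the rate `lam s(A)` as long as the scaling is controlled. -/
lemma potential_deriv_le {ε lam : ℝ} (hm : 0 < m) (hn : 0 < n) (hs : 0 < size A) (hε : 0 ≤ ε)
    (hlam : ε ≤ lam / 10) (hlam0 : 0 < lam) (hlam1 : lam ≤ 1) (hA : IsNearlyDoublyBalanced ε A)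
    (hgap : HasSpectralGap lam A) {L : Matrix (Fin m) (Fin m) ℝ} {R : Matrix (Fin n) (Fin n) ℝ}
    {B : Fin k → Matrix (Fin m) (Fin n) ℝ} (hB : ∀ i, B i = L * A i * R)
    (hc : IsControlled lam A B L R) :
    -(4 * size B * potential B) +
        4 * (inner ℝ (vec (errorE B)) (vec (errorE B * errorE B)) / m +
          inner ℝ (vec (errorF B)) (vec (errorF B * errorF B)) / n) -
        8 * inner ℝ (vec (errorE B)) (vec (cpMap B (errorF B))) ≤
      -(lam * size A) * potential B := by
  have hm' : (0 : ℝ) < m := by exact_mod_cast hm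
  have hn' : (0 : ℝ) < n := by exact_mod_cast hn
  have hP := potential_nonneg B
  have e1 : inner ℝ (vec (errorE B)) (vec (errorE B * errorE B)) / m +
      inner ℝ (vec (errorF B)) (vec (errorF B * errorF B)) / n ≤
      lam / 1000 * size A * potential B := by
    have h1 : inner ℝ (vec (errorE B)) (vec (errorE B * errorE B)) ≤
        lam / 1000 * size A * ‖vec (errorE B)‖ ^ 2 :=
      (inner_vec_mul_self_le _).trans (by gcongr; exact hc.norm_errorE)
    have h2 : inner ℝ (vec (errorF B)) (vec (errorF B * errorF B)) ≤
        lam / 1000 * size A * ‖vec (errorF B)‖ ^ 2 :=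
      (inner_vec_mul_self_le _).trans (by gcongr; exact hc.norm_errorF)
    unfold potential
    rw [mul_add, mul_div_assoc', mul_div_assoc']
    gcongr
  -- The gap is applied to F and -E, and the arithmetic-geometric mean inequality bounds
  -- ‖E‖‖F‖/√(mn) in Frobenius norms by half the potential. After multiplication by 8 the leading
  -- part cancels -4sΔ up to terms of order λ.
  have e2 : -inner ℝ (vec (errorE B)) (vec (cpMap B (errorF B))) ≤
      (1 - lam + ε + 60 * (lam / 1000)) * size A * (potential B / 2) := by
    have h1 := inner_cpMap_scaled_le hm hn hs hε (by linarith) (by linarith) hA hgap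
      (by linarith) hc.norm_left hc.norm_right (X := errorF B) (Y := -errorE B) (trace_errorF B)
      (by rw [Matrix.trace_neg, trace_errorE, neg_zero])
    have hBe : (fun i => L * A i * R) = B := (funext hB).symm
    rw [hBe, map_neg, inner_neg_left, norm_neg] at h1
    refine h1.trans ?_
    have h2 : ‖vec (errorF B)‖ * ‖vec (errorE B)‖ / √((m : ℝ) * n) ≤ potential B / 2 := by
      rw [Real.sqrt_mul hm'.le]
      unfold potential
      have a1 := Real.sq_sqrt hm'.le
      have a2 := Real.sq_sqrt hn'.le
      have a3 := Real.sqrt_pos.2 hm'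
      have a4 := Real.sqrt_pos.2 hn'
      have b1 : ‖vec (errorE B)‖ ^ 2 / m = (‖vec (errorE B)‖ / √m) ^ 2 := by rw [div_pow, a1]
      have b2 : ‖vec (errorF B)‖ ^ 2 / n = (‖vec (errorF B)‖ / √n) ^ 2 := by rw [div_pow, a2]
      have b3 : ‖vec (errorF B)‖ * ‖vec (errorE B)‖ / (√m * √n) =
          (‖vec (errorE B)‖ / √m) * (‖vec (errorF B)‖ / √n) := by field_simp
      rw [b1, b2, b3]
      nlinarith [sq_nonneg (‖vec (errorE B)‖ / √m - ‖vec (errorF B)‖ / √n)]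
    have hk : 0 ≤ (1 - lam + ε + 60 * (lam / 1000)) * size A := by
      apply mul_nonneg _ hs.le
      linarith
    calc _ = (1 - lam + ε + 60 * (lam / 1000)) * size A *
          (‖vec (errorF B)‖ * ‖vec (errorE B)‖ / √((m : ℝ) * n)) := by ring
      _ ≤ _ := by gcongr
  have e3 : (1 - lam / 1000) * size A * potential B ≤ size B * potential B := by
    gcongr
    exact hc.le_size
  have e4 : ε * (size A * potential B) ≤ lam / 10 * (size A * potential B) := by
    gcongr
  have e5 : 0 ≤ lam * (size A * potential B) := by positivity
  linarith

/-- A gradient flow with its scaling matrices, started at a nonzero nearly doubly balanced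
operator whose spectral gap is large compared with `ε`. -/
structure FlowData (ε lam : ℝ) (A : Fin k → Matrix (Fin m) (Fin n) ℝ)
    (𝒜 : ℝ → Fin k → Matrix (Fin m) (Fin n) ℝ) (L : ℝ → Matrix (Fin m) (Fin m) ℝ)
    (R : ℝ → Matrix (Fin n) (Fin n) ℝ) : Prop where
  two_le : 2 ≤ m
  pos : 0 < n
  eps_pos : 0 < ε
  lam_pos : 0 < lam
  lam_le_one : lam ≤ 1
  size_pos : 0 < size A
  balanced : IsNearlyDoublyBalanced ε A
  gap : HasSpectralGap lam A
  small : 1000000 * ε * Real.log m ≤ lam ^ 2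
  flow : IsGradientFlow A 𝒜
  left_zero : L 0 = 1
  right_zero : R 0 = 1
  left_deriv : ∀ t, 0 ≤ t → HasDerivWithinAt L (errorE (𝒜 t) * L t) (Ici 0) t
  right_deriv : ∀ t, 0 ≤ t → HasDerivWithinAt R (R t * errorF (𝒜 t)) (Ici 0) t

namespace FlowData

variable {ε lam : ℝ} {L : ℝ → Matrix (Fin m) (Fin m) ℝ} {R : ℝ → Matrix (Fin n) (Fin n) ℝ}
  (h : FlowData ε lam A 𝒜 L R)

include h

lemma m_pos : 0 < m := by have := h.two_le; omega

/-- A lower bound for log m turns the smallness of ε log m into smallness of ε itself. -/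
lemma half_lt_log : 1 / 2 < Real.log m := by
  have h2 : (2 : ℝ) ≤ m := by exact_mod_cast h.two_le
  have := Real.log_le_log two_pos h2
  linarith [Real.log_two_gt_d9]

lemma eps_log_le : ε * Real.log m ≤ lam / 1000000 * lam := by
  have := h.small
  nlinarith

lemma eps_le : ε ≤ lam / 500000 := by
  have h1 := h.half_lt_log
  have h2 := h.eps_log_le
  have h3 := h.lam_pos
  have h4 := h.lam_le_one
  have h5 := h.eps_pos
  nlinarith

lemma norm_errorE_zero : ‖errorE A‖ ≤ ε * size A :=
  h.balanced.norm_errorE_le h.eps_pos.le h.m_pos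

lemma norm_errorF_zero : ‖errorF A‖ ≤ ε * size A := by
  have := h.balanced.transpose.norm_errorE_le h.eps_pos.le h.pos
  rwa [errorE_transpose_operator, size_transpose_operator] at this

lemma potential_zero_le : potential A ≤ 2 * (ε * size A) ^ 2 := by
  refine (potential_le A h.m_pos h.pos).trans ?_
  have : ‖errorE A‖ ^ 2 ≤ (ε * size A) ^ 2 := by gcongr; exact h.norm_errorE_zero
  have : ‖errorF A‖ ^ 2 ≤ (ε * size A) ^ 2 := by gcongr; exact h.norm_errorF_zero
  linarith

lemma sqrt_pos : 0 < √(m : ℝ) := Real.sqrt_pos.2 (by exact_mod_cast h.m_pos)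

lemma rate_pos : 0 < lam * size A / 2 := by
  have := mul_pos h.lam_pos h.size_pos
  linarith

/-- The integral of the profile is of order `log m / (lam s(A))`. -/
lemma profileIntegral_le_log (t : ℝ) :
    4 * ε * size A * profileIntegral (lam * size A / 2) √m t ≤ 16 * (ε * Real.log m / lam) := by
  have h1 := profileIntegral_le h.rate_pos h.sqrt_pos t
  have h2 : Real.log (1 + √m) ≤ 2 * Real.log m := by
    have hm2 : (2 : ℝ) ≤ m := by exact_mod_cast h.two_le
    rw [← Real.log_rpow (by linarith), Real.rpow_two]
    apply Real.log_le_log (by positivity)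
    have : √(m : ℝ) ≤ m := Real.sqrt_le_iff.2 ⟨by linarith, by nlinarith⟩
    nlinarith
  have h3 := h.lam_pos
  have h4 := h.size_pos
  have h5 := h.eps_pos
  calc _ ≤ 4 * ε * size A * (2 * Real.log m / (lam * size A / 2)) := by
        gcongr
        exact h1.trans (by gcongr)
    _ = _ := by field_simp; ring

/-- With y = √m·exp(-λs(A)t/2), doubling gives 2εs(A) while y ≥ 1, and decay of the potential gives
2εs(A)·y always. The profile merges both at the cost of a factor 2. -/
lemma norm_errorE_le {T : ℝ} (hc : ∀ t ∈ Icc 0 T, IsControlled lam A (𝒜 t) (L t) (R t)) :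
    ∀ t ∈ Icc 0 T, ‖errorE (𝒜 t)‖ ≤ 4 * ε * size A * profile (lam * size A / 2) √m t := by
  have hlam := h.lam_pos
  have hs := h.size_pos
  have hε := h.eps_pos
  have hdecay : ∀ t ∈ Icc 0 T,
      potential (𝒜 t) * Real.exp (lam * size A * t) ≤ potential A := by
    have hexp : ∀ t, HasDerivAt (fun t => Real.exp (lam * size A * t))
        (Real.exp (lam * size A * t) * (lam * size A)) t := fun t => by
      simpa using ((hasDerivAt_id t).const_mul (lam * size A)).exp
    have hd : ∀ t, 0 ≤ t → HasDerivWithinAt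
        (fun t => potential (𝒜 t) * Real.exp (lam * size A * t)) _ (Ici 0) t := fun t ht =>
      (hasDerivWithinAt_potential h.m_pos h.pos fun i => h.flow.hasDerivWithinAt ht i).mul
        (hexp t).hasDerivWithinAt
    intro t ht
    refine image_le_of_deriv_right_le_deriv_boundary (B := fun _ => potential A)
      (B' := fun _ => 0) (a := 0) (b := T)
      (fun s hs => ((hd s hs.1).continuousWithinAt).mono Icc_subset_Ici_self)
      (fun s hs => (hd s hs.1).mono (Ici_subset_Ici.2 hs.1))
      (by rw [h.flow.1]; simp) continuousOn_const (fun s _ => hasDerivWithinAt_const _ _ _)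
      (fun s hs' => ?_) ht
    have h1 := potential_deriv_le h.m_pos h.pos hs hε.le (by linarith [h.eps_le]) hlam
      h.lam_le_one h.balanced h.gap
      (fun i => h.flow.eq_scaling h.left_zero h.right_zero h.left_deriv h.right_deriv hs'.1 i)
      (hc s (Ico_subset_Icc_self hs'))
    have h2 := mul_le_mul_of_nonneg_right h1 (Real.exp_pos (lam * size A * s)).le
    linarith
  intro t ht
  have h0 : Real.exp (-(lam * size A / 2) * t) ^ 2 = (Real.exp (lam * size A * t))⁻¹ := by
    rw [← Real.exp_nat_mul, ← Real.exp_neg]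
    congr 1
    push_cast
    ring
  have := le_profile (a := lam * size A / 2) (b := √m) (c := 2 * ε * size A)
    (x := ‖errorE (𝒜 t)‖) (t := t) h.sqrt_pos (by positivity)
    (fun h1 => by
      have hlog := h.half_lt_log
      have hm0 : (0 : ℝ) < m := by exact_mod_cast h.m_pos
      -- The condition y ≥ 1 says exactly that t ≤ log m / (λs(A)), which is short enough for the
      -- doubling bound.
      refine (h.flow.norm_error_le_of_le h.m_pos h.pos (T := Real.log m / (lam * size A)) hε hs
        (by positivity) ?_ h.norm_errorE_zero h.norm_errorF_zero t ⟨ht.1, ?_⟩).1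
      · have e : 32 * ε * size A * (Real.log m / (lam * size A)) =
            32 * (ε * Real.log m) / lam := by field_simp
        rw [e, div_lt_one hlam]
        nlinarith [h.eps_log_le, h.lam_le_one]
      · have h2 := Real.log_nonneg h1
        rw [Real.log_mul h.sqrt_pos.ne' (Real.exp_pos _).ne', Real.log_exp,
          Real.log_sqrt hm0.le] at h2
        rw [le_div_iff₀ (by positivity)]
        linarith)
    (by
      rw [← sq_le_sq₀ (norm_nonneg _) (by have := h.sqrt_pos; positivity)]
      refine (norm_errorE_sq_le _ h.m_pos).trans ?_
      have h3 : potential (𝒜 t) ≤ potential A * (Real.exp (lam * size A * t))⁻¹ := by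
        rw [← div_eq_mul_inv, le_div_iff₀ (Real.exp_pos _)]
        exact hdecay t ht
      have h4 := h.potential_zero_le
      rw [mul_pow, mul_pow √(m : ℝ), Real.sq_sqrt (Nat.cast_nonneg m), h0]
      calc (m : ℝ) * potential (𝒜 t)
          ≤ m * (2 * (ε * size A) ^ 2 * (Real.exp (lam * size A * t))⁻¹) := by
            gcongr
            exact h3.trans (by gcongr)
        _ ≤ m * (4 * (ε * size A) ^ 2 * (Real.exp (lam * size A * t))⁻¹) := by
            gcongr
            norm_num
        _ = _ := by ring)
  linarith

/-- Passing through the potential would cost √n. Instead, where ‖F‖ equals 2φ with ‖E‖ ≤ φ, damping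
contributes -4sφ and E drives by at most 2sφ plus quadratic terms; the net rate lies below -s(A)φ,
while the fence falls no faster than that. -/
lemma norm_errorF_le {T : ℝ} (hc : ∀ t ∈ Icc 0 T, IsControlled lam A (𝒜 t) (L t) (R t)) :
    ∀ t ∈ Icc 0 T,
      ‖errorF (𝒜 t)‖ ≤ 2 * (4 * ε * size A) * profile (lam * size A / 2) √m t := by
  have hlam := h.lam_pos
  have hlam1 := h.lam_le_one
  have hs := h.size_pos
  have hε := h.eps_pos
  have hb := h.sqrt_pos
  have hE := h.norm_errorE_le hc
  have hB := fun t => (hasDerivAt_profile (a := lam * size A / 2) hb t).const_mul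
    (2 * (4 * ε * size A))
  refine norm_le_of_fence (w := fun t => errorFRemainder (𝒜 t))
    (σ := fun t => 2 * size (𝒜 t))
    (fun t ht => hasDerivWithinAt_errorF h.m_pos h.pos fun i => h.flow.hasDerivWithinAt ht i)
    hB ?_ (fun t ht hy => ?_)
  · rw [h.flow.1]
    refine h.norm_errorF_zero.trans ?_
    -- The profile starts at √m/(1 + √m), so the fence starts above the initial error.
    have h1 : 1 / 2 ≤ profile (lam * size A / 2) √m 0 := by
      have hm1 : 1 ≤ √(m : ℝ) := Real.one_le_sqrt.2 (by exact_mod_cast h.m_pos)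
      simp only [profile, mul_zero, Real.exp_zero, mul_one]
      rw [le_div_iff₀ (by positivity)]
      linarith
    nlinarith [mul_pos hε hs]
  · have hc' := hc t (Ico_subset_Icc_self ht)
    have hE := hE t (Ico_subset_Icc_self ht)
    set q := profile (lam * size A / 2) √m t with hq
    have hq0 : 0 < q := profile_pos hb t
    have hq1 : q ≤ 1 := profile_le_one hb t
    set φ := 4 * ε * size A * q with hφ
    have hφ0 : 0 < φ := by positivity
    have hy' : ‖errorF (𝒜 t)‖ = 2 * φ := by rw [hy, hφ]; ring
    have hp : potential (𝒜 t) ≤ 5 * φ ^ 2 := by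
      refine (potential_le _ h.m_pos h.pos).trans ?_
      have : ‖errorE (𝒜 t)‖ ^ 2 ≤ φ ^ 2 := by gcongr
      rw [hy']
      linarith
    have hs0 := size_nonneg (𝒜 t)
    have hw : ‖errorFRemainder (𝒜 t)‖ ≤
        2 * (5 * φ ^ 2) + 2 * (2 * φ) ^ 2 + 2 * (φ * (size (𝒜 t) + 2 * φ)) := by
      refine (norm_errorFRemainder_le _).trans ?_
      rw [hy']
      gcongr
    have hφ1 : φ ≤ size A / 1000 := by
      have h1 : φ ≤ 4 * ε * size A := mul_le_of_le_one_right (by positivity) hq1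
      have h2 : ε ≤ 1 / 500000 := h.eps_le.trans (by linarith)
      nlinarith
    have hB' : -(size A * φ) ≤ 2 * (4 * ε * size A) *
        (-(lam * size A / 2) * q / (1 + √m * Real.exp (-(lam * size A / 2) * t))) := by
      have hD : 1 ≤ 1 + √(m : ℝ) * Real.exp (-(lam * size A / 2) * t) := by
        have : 0 ≤ √(m : ℝ) * Real.exp (-(lam * size A / 2) * t) := by positivity
        linarith
      have h1 : (lam * size A / 2) * q / (1 + √m * Real.exp (-(lam * size A / 2) * t)) ≤
          (lam * size A / 2) * q := div_le_self (by positivity) hD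
      rw [neg_mul, neg_div]
      have h2 : lam * (size A * φ) ≤ size A * φ :=
        mul_le_of_le_one_left (by positivity) hlam1
      have h3 := mul_le_mul_of_nonneg_left h1 (by positivity : 0 ≤ 2 * (4 * ε * size A))
      have h4 : 2 * (4 * ε * size A) * (lam * size A / 2 * q) = lam * (size A * φ) := by
        rw [hφ]; ring
      linarith
    refine lt_of_lt_of_le ?_ hB'
    rw [hy']
    have h5 : 999 / 1000 * size A ≤ size (𝒜 t) := by
      refine le_trans ?_ hc'.le_size
      gcongr
      linarith
    have h6 := mul_le_mul_of_nonneg_left h5 hφ0.le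
    have h7 := mul_le_mul_of_nonneg_left hφ1 hφ0.le
    nlinarith [mul_pos hφ0 hs]

lemma norm_left_deriv_le {T : ℝ} (hc : ∀ t ∈ Icc 0 T, IsControlled lam A (𝒜 t) (L t) (R t)) :
    ∀ t ∈ Icc 0 T, ‖errorE (𝒜 t) * L t‖ ≤
      2 * (4 * ε * size A) * profile (lam * size A / 2) √m t := by
  intro t ht
  have h1 := h.norm_errorE_le hc t ht
  have h2 : ‖L t‖ ≤ 2 := (norm_le_one_add (hc t ht).norm_left).trans (by linarith [h.lam_le_one])
  calc _ ≤ ‖errorE (𝒜 t)‖ * ‖L t‖ := norm_mul_le _ _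
    _ ≤ (4 * ε * size A * profile (lam * size A / 2) √m t) * 2 := by
        gcongr
        exact (norm_nonneg _).trans h1
    _ = _ := by ring

lemma norm_right_deriv_le {T : ℝ} (hc : ∀ t ∈ Icc 0 T, IsControlled lam A (𝒜 t) (L t) (R t)) :
    ∀ t ∈ Icc 0 T, ‖R t * errorF (𝒜 t)‖ ≤
      4 * (4 * ε * size A) * profile (lam * size A / 2) √m t := by
  intro t ht
  have h1 := h.norm_errorF_le hc t ht
  have h2 : ‖R t‖ ≤ 2 := (norm_le_one_add (hc t ht).norm_right).trans (by linarith [h.lam_le_one])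
  calc _ ≤ ‖R t‖ * ‖errorF (𝒜 t)‖ := norm_mul_le _ _
    _ ≤ 2 * (2 * (4 * ε * size A) * profile (lam * size A / 2) √m t) := by
        gcongr
    _ = _ := by ring

omit h in
lemma norm_sub_one_le_of_deriv {d : ℕ} {Y Y' : ℝ → Matrix (Fin d) (Fin d) ℝ} {T a b c : ℝ}
    (ha : 0 < a) (hb : 0 < b) (h0 : Y 0 = 1)
    (hY : ∀ t, 0 ≤ t → HasDerivWithinAt Y (Y' t) (Ici 0) t)
    (hY' : ∀ t ∈ Icc 0 T, ‖Y' t‖ ≤ c * profile a b t) :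
    ∀ t ∈ Icc 0 T, ‖Y t - 1‖ ≤ c * profileIntegral a b t := by
  refine image_norm_le_of_norm_deriv_right_le_deriv_boundary (f := fun t => Y t - 1)
    (f' := Y') (B' := fun t => c * profile a b t)
    (fun t ht => (((hY t ht.1).continuousWithinAt).mono Icc_subset_Ici_self).sub
      continuousWithinAt_const)
    (fun t ht => ((hY t ht.1).mono (Ici_subset_Ici.2 ht.1)).sub_const _)
    (by simp [h0, profileIntegral_zero])
    (fun t => (hasDerivAt_profileIntegral ha hb t).const_mul c)
    (fun t ht => hY' t (Ico_subset_Icc_self ht))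

lemma norm_left_sub_one_le {T : ℝ}
    (hc : ∀ t ∈ Icc 0 T, IsControlled lam A (𝒜 t) (L t) (R t)) :
    ∀ t ∈ Icc 0 T, ‖L t - 1‖ ≤ 64 * (ε * Real.log m / lam) := by
  intro t ht
  have h1 := norm_sub_one_le_of_deriv h.rate_pos h.sqrt_pos h.left_zero h.left_deriv
    (h.norm_left_deriv_le hc) t ht
  have h2 := h.profileIntegral_le_log t
  have h3 := (norm_nonneg _).trans h1
  linarith

/-- The derivative bound is four times the function whose integral is at most 16ε log m / λ, hence
64; the left factor would allow 32. -/
lemma norm_right_sub_one_le {T : ℝ}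
    (hc : ∀ t ∈ Icc 0 T, IsControlled lam A (𝒜 t) (L t) (R t)) :
    ∀ t ∈ Icc 0 T, ‖R t - 1‖ ≤ 64 * (ε * Real.log m / lam) := by
  intro t ht
  have h1 := norm_sub_one_le_of_deriv h.rate_pos h.sqrt_pos h.right_zero h.right_deriv
    (h.norm_right_deriv_le hc) t ht
  have h2 := h.profileIntegral_le_log t
  linarith

lemma eps_log_div_le : ε * Real.log m / lam ≤ lam / 1000000 := by
  rw [div_le_iff₀ h.lam_pos]
  exact h.eps_log_le

/-- The rate of loss 2Δ is quadratic in the errors, hence at most s(A) times the linear error bound,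
whose integral is already controlled. -/
lemma size_sub_le {T : ℝ} (hc : ∀ t ∈ Icc 0 T, IsControlled lam A (𝒜 t) (L t) (R t)) :
    ∀ t ∈ Icc 0 T, size A - size (𝒜 t) ≤ lam / 2000 * size A := by
  have hlam := h.lam_pos
  have hs := h.size_pos
  have hε := h.eps_pos
  have hd : ∀ t, 0 ≤ t → HasDerivWithinAt (fun t => size A - size (𝒜 t))
      (-(-(2 * potential (𝒜 t)))) (Ici 0) t := fun t ht =>
    (hasDerivWithinAt_size_flow h.m_pos h.pos
      fun i => h.flow.hasDerivWithinAt ht i).const_sub (size A)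
  have hb := h.sqrt_pos
  intro t ht
  have key := image_le_of_deriv_right_le_deriv_boundary
    (f := fun t => size A - size (𝒜 t))
    (B := fun t => size A * (4 * ε * size A * profileIntegral (lam * size A / 2) √m t))
    (B' := fun t => size A * (4 * ε * size A * profile (lam * size A / 2) √m t))
    (a := 0) (b := T)
    (fun s hs => ((hd s hs.1).continuousWithinAt).mono Icc_subset_Ici_self)
    (fun s hs => (hd s hs.1).mono (Ici_subset_Ici.2 hs.1))
    (by rw [h.flow.1, profileIntegral_zero]; simp)
    (fun s _ => (((hasDerivAt_profileIntegral h.rate_pos hb s).const_mul _).const_mul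
      _).continuousAt.continuousWithinAt)
    (fun s _ => (((hasDerivAt_profileIntegral h.rate_pos hb s).const_mul _).const_mul
      _).hasDerivWithinAt)
    (fun s hs' => by
      have h1 := h.norm_errorE_le hc s (Ico_subset_Icc_self hs')
      have h2 := h.norm_errorF_le hc s (Ico_subset_Icc_self hs')
      have hq0 : 0 < profile (lam * size A / 2) √m s := profile_pos hb s
      have hq1 : profile (lam * size A / 2) √m s ≤ 1 := profile_le_one hb s
      set q := profile (lam * size A / 2) √m s
      set φ := 4 * ε * size A * q with hφ
      have hφ0 : 0 < φ := by positivity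
      have hφ1 : φ ≤ size A / 1000 := by
        have h1 : φ ≤ 4 * ε * size A := mul_le_of_le_one_right (by positivity) hq1
        have h2 : ε ≤ 1 / 500000 := h.eps_le.trans (by linarith [h.lam_le_one])
        nlinarith
      have h2' : ‖errorF (𝒜 s)‖ ≤ 2 * φ := h2.trans (by rw [hφ]; linarith)
      have hp : potential (𝒜 s) ≤ 5 * φ ^ 2 := by
        refine (potential_le _ h.m_pos h.pos).trans ?_
        have : ‖errorE (𝒜 s)‖ ^ 2 ≤ φ ^ 2 := by gcongr
        have : ‖errorF (𝒜 s)‖ ^ 2 ≤ (2 * φ) ^ 2 := by gcongr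
        linarith
      nlinarith) ht
  have h1 := h.profileIntegral_le_log t
  have h2 := h.eps_log_div_le
  have h3 : 4 * ε * size A * profileIntegral (lam * size A / 2) √m t ≤ lam / 2000 := by linarith
  refine key.trans ?_
  rw [mul_comm]
  gcongr

/-- The scaling stays controlled for all times. -/
lemma isControlled : ∀ t, 0 ≤ t → IsControlled lam A (𝒜 t) (L t) (R t) := by
  have hlam := h.lam_pos
  have hs := h.size_pos
  have hε := h.eps_pos
  -- All conditions of `IsControlled` are scaled into one continuous function, so that being
  -- controlled means f ≤ λ/1000. The estimates under this assumption give half of it.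
  let f : ℝ → ℝ := fun t => max (max ‖L t - 1‖ ‖R t - 1‖)
    (max (max (‖errorE (𝒜 t)‖ / size A) (‖errorF (𝒜 t)‖ / size A))
      ((size A - size (𝒜 t)) / size A))
  have hLc : ContinuousOn L (Ici 0) := fun t ht => (h.left_deriv t ht).continuousWithinAt
  have hRc : ContinuousOn R (Ici 0) := fun t ht => (h.right_deriv t ht).continuousWithinAt
  have hEc := h.flow.continuousOn_errorE
  have hFc := h.flow.continuousOn_errorF
  have hsc : ContinuousOn (fun t => size (𝒜 t)) (Ici 0) :=
    contDiff_size.continuous.comp_continuousOn h.flow.continuousOn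
  have hf : ContinuousOn f (Ici 0) :=
    ContinuousOn.sup
      (ContinuousOn.sup (hLc.sub continuousOn_const).norm (hRc.sub continuousOn_const).norm)
      (ContinuousOn.sup
        (ContinuousOn.sup (hEc.norm.div_const _) (hFc.norm.div_const _))
        ((continuousOn_const.sub hsc).div_const _))
  have hiff : ∀ t, f t ≤ lam / 1000 ↔ IsControlled lam A (𝒜 t) (L t) (R t) := by
    intro t
    simp only [f, max_le_iff, div_le_iff₀ hs]
    constructor
    · rintro ⟨⟨h1, h2⟩, ⟨h3, h4⟩, h5⟩
      exact ⟨h1, h2, h3, h4, by linarith⟩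
    · rintro ⟨h1, h2, h3, h4, h5⟩
      exact ⟨⟨h1, h2⟩, ⟨h3, h4⟩, by linarith⟩
  have hεlam := h.eps_le
  have key := le_of_self_improving (f := f) (η := lam / 1000) (by positivity) hf
    (by
      have h0 : f 0 ≤ lam / 2000 := by
        simp only [f, h.left_zero, h.right_zero, h.flow.1, sub_self, norm_zero, max_le_iff,
          div_le_iff₀ hs]
        refine ⟨⟨by positivity, by positivity⟩, ⟨h.norm_errorE_zero.trans ?_,
          h.norm_errorF_zero.trans ?_⟩, by positivity⟩ <;> gcongr <;> linarith
      linarith)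
    (fun t ht hτ => by
      have hc : ∀ τ ∈ Icc 0 t, IsControlled lam A (𝒜 τ) (L τ) (R τ) :=
        fun τ hτ' => (hiff τ).1 (hτ τ hτ')
      have htt : t ∈ Icc 0 t := ⟨ht, le_rfl⟩
      have hq1 : profile (lam * size A / 2) √m t ≤ 1 := profile_le_one h.sqrt_pos t
      have h1 := h.eps_log_div_le
      have h2 : 2 * (4 * ε * size A) * profile (lam * size A / 2) √m t ≤
          lam / 1000 / 2 * size A := by
        refine (mul_le_of_le_one_right (by positivity) hq1).trans ?_
        nlinarith
      have h3 : 0 < 4 * ε * size A * profile (lam * size A / 2) √m t :=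
        mul_pos (by positivity) (profile_pos h.sqrt_pos t)
      simp only [f, max_le_iff, div_le_iff₀ hs]
      refine ⟨⟨(h.norm_left_sub_one_le hc t htt).trans ?_,
        (h.norm_right_sub_one_le hc t htt).trans ?_⟩,
        ⟨(h.norm_errorE_le hc t htt).trans ?_, (h.norm_errorF_le hc t htt).trans h2⟩,
        (h.size_sub_le hc t htt).trans ?_⟩
      · linarith
      · linarith
      · linarith
      · linarith)
  exact fun t ht => (hiff t).1 (key t ht)

/-- Bounds and limits of the scaling matrices. -/
lemma bounds_and_limits :
    (∀ t, 0 ≤ t → ‖L t - 1‖ ≤ 64 * (ε * Real.log m / lam)) ∧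
    (∀ t, 0 ≤ t → ‖R t - 1‖ ≤ 64 * (ε * Real.log m / lam)) ∧
    (∃ Linf, Tendsto L atTop (𝓝 Linf)) ∧ (∃ Rinf, Tendsto R atTop (𝓝 Rinf)) ∧
    Tendsto (fun t => errorE (𝒜 t)) atTop (𝓝 0) ∧
    Tendsto (fun t => errorF (𝒜 t)) atTop (𝓝 0) := by
  have hc : ∀ T, ∀ t ∈ Icc 0 T, IsControlled lam A (𝒜 t) (L t) (R t) :=
    fun T t ht => h.isControlled t ht.1
  have : CompleteSpace (Matrix (Fin m) (Fin m) ℝ) := FiniteDimensional.complete ℝ _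
  have : CompleteSpace (Matrix (Fin n) (Fin n) ℝ) := FiniteDimensional.complete ℝ _
  have lim : ∀ c : ℝ, Tendsto (fun t => c * profile (lam * size A / 2) √m t) atTop (𝓝 0) :=
    fun c => by simpa using (tendsto_profile h.rate_pos √m).const_mul c
  refine ⟨fun t ht => h.norm_left_sub_one_le (hc t) t ⟨ht, le_rfl⟩,
    fun t ht => h.norm_right_sub_one_le (hc t) t ⟨ht, le_rfl⟩,
    exists_tendsto_of_norm_deriv_le h.rate_pos h.sqrt_pos h.left_deriv
      fun t ht => h.norm_left_deriv_le (hc t) t ⟨ht, le_rfl⟩,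
    exists_tendsto_of_norm_deriv_le h.rate_pos h.sqrt_pos h.right_deriv
      fun t ht => h.norm_right_deriv_le (hc t) t ⟨ht, le_rfl⟩, ?_, ?_⟩
  · refine squeeze_zero_norm' ?_ (lim (4 * ε * size A))
    filter_upwards [eventually_ge_atTop 0] with t ht
    exact h.norm_errorE_le (hc t) t ⟨ht, le_rfl⟩
  · refine squeeze_zero_norm' ?_ (lim (2 * (4 * ε * size A)))
    filter_upwards [eventually_ge_atTop 0] with t ht
    exact h.norm_errorF_le (hc t) t ⟨ht, le_rfl⟩

end FlowData

end Estimates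

end OperatorScaling
namespace OperatorScaling

open Set Filter Topology Matrix

/-! ### Degenerate cases and the final assembly. -/

section Conclusion

variable {m n k : ℕ} {A : Fin k → Matrix (Fin m) (Fin n) ℝ}
  {𝒜 : ℝ → Fin k → Matrix (Fin m) (Fin n) ℝ}

lemma IsNearlyDoublyBalanced.mono {ε ε' : ℝ} (h : IsNearlyDoublyBalanced ε A) (hε : ε ≤ ε') :
    IsNearlyDoublyBalanced ε' A := by
  have hs := size_nonneg A
  have psd : ∀ {p : ℕ} {c : ℝ}, 0 ≤ c → (c • (1 : Matrix (Fin p) (Fin p) ℝ)).PosSemidef :=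
    fun hc => Matrix.PosSemidef.one.smul hc
  have nn : ∀ p : ℕ, 0 ≤ (ε' - ε) * (size A / p) :=
    fun p => mul_nonneg (by linarith) (by positivity)
  obtain ⟨h1, h2, h3, h4⟩ := h
  refine ⟨?_, ?_, ?_, ?_⟩
  · convert h1.add (psd (nn m)) using 1; module
  · convert h2.add (psd (nn m)) using 1; module
  · convert h3.add (psd (nn n)) using 1; module
  · convert h4.add (psd (nn n)) using 1; module

lemma IsWellConditioned.mono {d : ℕ} {x y : ℝ} {M : Matrix (Fin d) (Fin d) ℝ}
    (h : IsWellConditioned x M) (hxy : x ≤ y) : IsWellConditioned y M :=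
  ⟨h.1, h.2.1.trans (by linarith), h.2.2.trans hxy⟩

lemma size_eq_zero_iff : size A = 0 ↔ A = 0 := by
  rw [size_eq_sum_norm_vec, Finset.sum_eq_zero_iff_of_nonneg (fun i _ => by positivity)]
  simp only [Finset.mem_univ, true_implies, pow_eq_zero_iff two_ne_zero, norm_eq_zero,
    vec_eq_zero]
  exact ⟨fun h => funext h, fun h i => congrFun h i⟩

lemma HasSpectralGap.le_one {lam : ℝ} (h : HasSpectralGap lam A) (hm : 0 < m) (hn : 0 < n)
    (hs : 0 < size A) : lam ≤ 1 := by
  have hm' : (0 : ℝ) < m := by exact_mod_cast hm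
  have hn' : (0 : ℝ) < n := by exact_mod_cast hn
  have h1 : 0 ≤ (1 - lam) * (size A / √((m : ℝ) * n)) :=
    (LinearMap.singularValues_nonneg _ 1).trans h
  have h2 : 0 < size A / √((m : ℝ) * n) := by positivity
  linarith [nonneg_of_mul_nonneg_left h1 h2]

/-- Uniform bounds and limits of the scaling matrices, including the degenerate cases. -/
lemma exists_bounds_and_limits {ε lam : ℝ} {L : ℝ → Matrix (Fin m) (Fin m) ℝ}
    {R : ℝ → Matrix (Fin n) (Fin n) ℝ} (hm : 2 ≤ m) (hn : 0 < n) (hε : 0 ≤ ε) (hlam : 0 < lam)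
    (hA : IsNearlyDoublyBalanced ε A) (hgap : HasSpectralGap lam A)
    (hsmall : 1000000 * ε * Real.log m ≤ lam ^ 2) (hflow : IsGradientFlow A 𝒜) (hL0 : L 0 = 1)
    (hR0 : R 0 = 1) (hL : ∀ t, 0 ≤ t → HasDerivWithinAt L (errorE (𝒜 t) * L t) (Ici 0) t)
    (hR : ∀ t, 0 ≤ t → HasDerivWithinAt R (R t * errorF (𝒜 t)) (Ici 0) t) :
    ∃ y : ℝ, y ≤ 1 / 2 ∧ y ≤ 64 * (ε * Real.log m / lam) ∧
      (∀ t, 0 ≤ t → ‖L t - 1‖ ≤ y) ∧ (∀ t, 0 ≤ t → ‖R t - 1‖ ≤ y) ∧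
      (∃ Linf, Tendsto L atTop (𝓝 Linf)) ∧ (∃ Rinf, Tendsto R atTop (𝓝 Rinf)) ∧
      Tendsto (fun t => errorE (𝒜 t)) atTop (𝓝 0) ∧
      Tendsto (fun t => errorF (𝒜 t)) atTop (𝓝 0) := by
  have hm0 : 0 < m := by omega
  have hlog : 0 < Real.log m := Real.log_pos (by exact_mod_cast hm)
  rcases (size_nonneg A).eq_or_lt with hs | hs
  · have hA0 : A = 0 := size_eq_zero_iff.1 hs.symm
    have h𝒜 : ∀ t, 0 ≤ t → 𝒜 t = 0 := fun t ht => by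
      ext1 i
      rw [hflow.eq_scaling hL0 hR0 hL hR ht i, hA0]
      simp
    have hE : ∀ t, 0 ≤ t → errorE (𝒜 t) = 0 := fun t ht => by
      simp [h𝒜 t ht, errorE, size, leftGram]
    have hF : ∀ t, 0 ≤ t → errorF (𝒜 t) = 0 := fun t ht => by
      simp [h𝒜 t ht, errorF, size, rightGram]
    have hL1 : ∀ t, 0 ≤ t → ‖L t - 1‖ ≤ 0 := fun t ht => by
      rw [← mul_zero (profileIntegral 1 1 t), mul_comm]
      refine FlowData.norm_sub_one_le_of_deriv (T := t) (c := 0) one_pos one_pos hL0 hL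
        (fun s hs => ?_) t ⟨ht, le_rfl⟩
      rw [hE s hs.1]
      simp
    have hR1 : ∀ t, 0 ≤ t → ‖R t - 1‖ ≤ 0 := fun t ht => by
      rw [← mul_zero (profileIntegral 1 1 t), mul_comm]
      refine FlowData.norm_sub_one_le_of_deriv (T := t) (c := 0) one_pos one_pos hR0 hR
        (fun s hs => ?_) t ⟨ht, le_rfl⟩
      rw [hF s hs.1]
      simp
    have lim : ∀ {V : Type} [TopologicalSpace V] {f : ℝ → V} {c : V},
        (∀ t, 0 ≤ t → f t = c) → Tendsto f atTop (𝓝 c) := fun hf =>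
      tendsto_const_nhds.congr' (by
        filter_upwards [eventually_ge_atTop 0] with t ht
        exact (hf t ht).symm)
    exact ⟨0, by norm_num, by positivity, hL1, hR1,
      ⟨1, lim fun t ht => sub_eq_zero.1 (norm_le_zero_iff.1 (hL1 t ht))⟩,
      ⟨1, lim fun t ht => sub_eq_zero.1 (norm_le_zero_iff.1 (hR1 t ht))⟩, lim hE, lim hF⟩
  · have hlam1 := hgap.le_one hm0 hn hs
    have data : ∀ ε', 0 < ε' → ε ≤ ε' → 1000000 * ε' * Real.log m ≤ lam ^ 2 →
        FlowData ε' lam A 𝒜 L R := fun ε' h1 h2 h3 =>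
      ⟨hm, hn, h1, hlam, hlam1, hs, hA.mono h2, hgap, h3, hflow, hL0, hR0, hL, hR⟩
    rcases hε.eq_or_lt with h0 | h0
    · have hη : 0 < lam ^ 2 / (1000000 * Real.log m) := by positivity
      have small : ∀ ε', ε' ≤ lam ^ 2 / (1000000 * Real.log m) →
          1000000 * ε' * Real.log m ≤ lam ^ 2 := fun ε' h1 => by
        rw [le_div_iff₀ (by positivity)] at h1
        linarith
      have squeeze : ∀ z : ℝ, (∀ ε', 0 < ε' → 1000000 * ε' * Real.log m ≤ lam ^ 2 →
          z ≤ 64 * (ε' * Real.log m / lam)) → z ≤ 0 := by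
        intro z hz
        by_contra! hcon
        have h1 : 0 < z * lam / (128 * Real.log m) := by positivity
        have h2 := hz (min (lam ^ 2 / (1000000 * Real.log m)) (z * lam / (128 * Real.log m)))
          (lt_min hη h1) (small _ (min_le_left _ _))
        have h3 : 64 * (min (lam ^ 2 / (1000000 * Real.log m)) (z * lam / (128 * Real.log m)) *
            Real.log m / lam) ≤ 64 * (z * lam / (128 * Real.log m) * Real.log m / lam) := by
          gcongr
          exact min_le_right _ _
        have h4 : 64 * (z * lam / (128 * Real.log m) * Real.log m / lam) = z / 2 := by
          field_simp
          norm_num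
        linarith
      have hb := (data _ hη (by rw [← h0]; exact hη.le) (small _ le_rfl)).bounds_and_limits
      refine ⟨0, by norm_num, by positivity, fun t ht => squeeze _ fun ε' h1 h2 => ?_,
        fun t ht => squeeze _ fun ε' h1 h2 => ?_, hb.2.2⟩
      · exact (data ε' h1 (by linarith) h2).bounds_and_limits.1 t ht
      · exact (data ε' h1 (by linarith) h2).bounds_and_limits.2.1 t ht
    · have hd := data ε h0 le_rfl hsmall
      exact ⟨64 * (ε * Real.log m / lam), by linarith [hd.eps_log_div_le], le_rfl,
        hd.bounds_and_limits⟩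

lemma size_scaling_pos {L : Matrix (Fin m) (Fin m) ℝ} {R : Matrix (Fin n) (Fin n) ℝ}
    (hL : IsUnit L) (hR : IsUnit R) (hA : A ≠ 0) : 0 < size (fun i => L * A i * R) := by
  refine lt_of_le_of_ne (size_nonneg _) fun h => hA ?_
  have h0 := size_eq_zero_iff.1 h.symm
  obtain ⟨L', hL'⟩ := hL.exists_left_inv
  obtain ⟨R', hR'⟩ := hR.exists_right_inv
  ext1 i
  have hi : L * A i * R = 0 := congrFun h0 i
  calc A i = (L' * L) * A i * (R * R') := by rw [hL', hR', Matrix.one_mul, Matrix.mul_one]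
    _ = L' * (L * A i * R) * R' := by simp only [Matrix.mul_assoc]
    _ = 0 := by rw [hi]; simp

end Conclusion

end OperatorScaling

open OperatorScaling
theorem theoremt :
    ∃ C K : ℝ, 0 < C ∧ 0 < K ∧
      ∀ (m n k : ℕ), 2 ≤ m → 1 ≤ n →
      ∀ (A : Fin k → Matrix (Fin m) (Fin n) ℝ) (ε lam : ℝ), 0 ≤ ε → 0 < lam →
        IsNearlyDoublyBalanced ε A → HasSpectralGap lam A →
        C * ε * Real.log m ≤ lam ^ 2 →
        -- the gradient flow started at `A` exists for all times `t ≥ 0`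
        (∃ 𝒜 : ℝ → Fin k → Matrix (Fin m) (Fin n) ℝ, IsGradientFlow A 𝒜) ∧
        ∀ 𝒜 : ℝ → Fin k → Matrix (Fin m) (Fin n) ℝ, IsGradientFlow A 𝒜 →
          ∃ (L : ℝ → Matrix (Fin m) (Fin m) ℝ) (R : ℝ → Matrix (Fin n) (Fin n) ℝ),
            -- the scaling matrices of the flow and their bounds at every time `t ≥ 0`
            (∀ t : ℝ, 0 ≤ t →
              IsLeftProductIntegral (fun τ => errorE (𝒜 τ)) 0 t (L t) ∧
              IsRightProductIntegral (fun τ => errorF (𝒜 τ)) 0 t (R t) ∧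
              (∀ i, 𝒜 t i = L t * A i * R t) ∧
              IsWellConditioned (K * (ε * Real.log m / lam)) (L t) ∧
              IsWellConditioned (K * (ε * Real.log m / lam)) (R t)) ∧
            -- the final scaling solution and its bounds
            ∃ (Linf : Matrix (Fin m) (Fin m) ℝ) (Rinf : Matrix (Fin n) (Fin n) ℝ),
              Filter.Tendsto L Filter.atTop (nhds Linf) ∧
              Filter.Tendsto R Filter.atTop (nhds Rinf) ∧
              IsDoublyBalanced (fun i => Linf * A i * Rinf) ∧
              (A ≠ 0 → 0 < size (fun i => Linf * A i * Rinf)) ∧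
              IsWellConditioned (K * (ε * Real.log m / lam)) Linf ∧
              IsWellConditioned (K * (ε * Real.log m / lam)) Rinf := by
  -- The first constant is that of `FlowData.small`; the second is 64 from the distance to the
  -- identity times 4 from its conversion to a condition number.
  refine ⟨1000000, 256, by norm_num, by norm_num, ?_⟩
  intro m n k hm hn A ε lam hε hlam hA hgap hsmall
  have hm0 : 0 < m := by omega
  refine ⟨exists_isGradientFlow hm0 hn A, fun 𝒜 hflow => ?_⟩
  obtain ⟨L, hL0, hL⟩ := exists_linear_solution hflow.continuousOn_errorE
  -- F is symmetric, so the transpose of a solution of Y' = F Y solves R' = R F; the right factor is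
  -- obtained as this transpose.
  obtain ⟨Y, hY0, hY⟩ := exists_linear_solution hflow.continuousOn_errorF
  have hR0 : (fun t => (Y t)ᵀ) 0 = 1 := by simp [hY0]
  have hR : ∀ t, 0 ≤ t →
      HasDerivWithinAt (fun t => (Y t)ᵀ) ((Y t)ᵀ * errorF (𝒜 t)) (Set.Ici 0) t := by
    intro t ht
    have := hasDerivWithinAt_transpose (hY t ht)
    rwa [Matrix.transpose_mul, errorF_transpose] at this
  obtain ⟨y, hy1, hy2, hLy, hRy, ⟨Linf, hLinf⟩, ⟨Rinf, hRinf⟩, hE, hF⟩ :=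
    exists_bounds_and_limits hm hn hε hlam hA hgap hsmall hflow hL0 hR0 hL hR
  have hscal := fun t (ht : 0 ≤ t) => hflow.eq_scaling hL0 hR0 hL hR ht
  have well : ∀ {d : ℕ} {M : Matrix (Fin d) (Fin d) ℝ}, 0 < d → ‖M - 1‖ ≤ y →
      IsWellConditioned (256 * (ε * Real.log m / lam)) M := fun hd hM =>
    (isWellConditioned_of_norm_sub_one_le hd hy1 hM).mono (by linarith)
  have hLinf_le : ‖Linf - 1‖ ≤ y := by
    refine le_of_tendsto (hLinf.sub_const 1).norm ?_
    filter_upwards [Filter.eventually_ge_atTop 0] with t ht using hLy t ht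
  have hRinf_le : ‖Rinf - 1‖ ≤ y := by
    refine le_of_tendsto (hRinf.sub_const 1).norm ?_
    filter_upwards [Filter.eventually_ge_atTop 0] with t ht using hRy t ht
  have hlim : Filter.Tendsto 𝒜 Filter.atTop (nhds fun i => Linf * A i * Rinf) := by
    have hcont : Continuous fun z : Matrix (Fin m) (Fin m) ℝ × Matrix (Fin n) (Fin n) ℝ =>
        fun i => z.1 * A i * z.2 :=
      continuous_pi fun i => (continuous_fst.matrix_mul continuous_const).matrix_mul continuous_snd
    refine ((hcont.tendsto (Linf, Rinf)).comp (hLinf.prodMk_nhds hRinf)).congr' ?_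
    filter_upwards [Filter.eventually_ge_atTop 0] with t ht
    exact funext fun i => (hscal t ht i).symm
  refine ⟨L, fun t => (Y t)ᵀ, fun t ht => ⟨?_, ?_, hscal t ht, well hm0 (hLy t ht),
    well hn (hRy t ht)⟩, Linf, Rinf, hLinf, hRinf, ?_, ?_, well hm0 hLinf_le, well hn hRinf_le⟩
  · exact isLeftProductIntegral_of_hasDerivWithinAt hflow.continuousOn_errorE hL0 hL ht
  · exact (isLeftProductIntegral_of_hasDerivWithinAt hflow.continuousOn_errorF hY0 hY
      ht).transpose fun τ => errorF_transpose _
  -- The errors of the trajectory tend to 0 and, by continuity, to those of the limit operator.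
  · exact isDoublyBalanced_of_error_eq_zero hm0 hn
      (tendsto_nhds_unique ((contDiff_errorE.continuous.tendsto _).comp hlim) hE)
      (tendsto_nhds_unique ((contDiff_errorF.continuous.tendsto _).comp hlim) hF)
  · exact size_scaling_pos (well hm0 hLinf_le).1 (well hn hRinf_le).1
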